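/- \textbf{Proposition (Comparison principle).} Let $N\in\{1,2,\dots\}$, $0<\alpha<N$, $p>0$, $\varepsilon>0$, let $V\in C(\mathbb R^N;[0,\infty))$ be not identically zero and let $H_\varepsilon:\mathbb R^N\to[0,\infty)$ be measurable. For $x\ne0$ let $$I_\alpha(x)=\frac{\Gamma(\frac{N-\alpha}2)}{\Gamma(\frac\alpha2)\,\pi^{N/2}\,2^\alpha\,|x|^{N-\alpha}}$$ be the Riesz kernel, and let $$C_\alpha=\frac1{2^\alpha}\Bigl(\frac{\Gamma(\frac{N-\alpha}4)}{\Gamma(\frac{N+\alpha}4)}\Bigr)^2$$ be the optimal constant in the inequality $\int_{\mathbb R^N}|I_{\alpha/2}*f|^2\le C_\alpha\int_{\mathbb R^N}|f(x)|^2|x|^\alpha\,dx$. For an open set $\Omega\subseteq\mathbb R^N$ let $H^1_{V,0}(\Omega)$ be the completion of $C_c^\infty(\Omega)$ with respect to the norm given by $\|\varphi\|_\varepsilon^2=\int_{\mathbb R^N}\varepsilon^2|\nabla\varphi|^2+V|\varphi|^2$, regarded as a space of functions in $L^2_{\mathrm{loc}}(\mathbb R^N)$ with a weak gradient (they vanish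 almost everywhere outside $\Omega$), and let $H^1_V(\mathbb R^N)=H^1_{V,0}(\mathbb R^N)$. Assume $(H_2)$ there is $\kappa>0$ such that $C_\alpha p\kappa<1$ and, for every $\varphi\in H^1_V(\mathbb R^N)$, $$\frac1{\varepsilon^\alpha}\int_{\mathbb R^N}|H_\varepsilon(x)\varphi(x)|^2|x|^\alpha\,dx\le\kappa\int_{\mathbb R^N}\varepsilon^2|\nabla\varphi|^2+V|\varphi|^2 .$$ Let $\Omega\subseteq\mathbb R^N$ be open and let $u\in H^1_{\mathrm{loc}}(\Omega)\cap L^2(\Omega,H_\varepsilon(x)^2|x|^\alpha\,dx)$ satisfy weakly $$-\varepsilon^2\Delta u+Vu\le\frac p{\varepsilon^\alpha}(I_\alpha*H_\varepsilon u)H_\varepsilon\quad\text{in }\Omega,$$ that is, for every $\varphi\in H^1(\Omega)$ with $\varphi\ge0$ and with compact support in $\Omega$, $$\int_\Omega\varepsilon^2\,\nabla u\cdot\nabla\varphi+Vu\varphi\le\frac p{\varepsilon^\alpha}\int_\Omega\int_\Omega I_\alpha(x-y)\,H_\varepsilon(y)u(y)\,H_\varepsilon(x)\varphi(x)\,dy\,dx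 .$$ If $u_+=\max(u,0)$, extended by zero outside $\Omega$, belongs to $H^1_{V,0}(\Omega)$, then $u\le0$ almost everywhere in $\Omega$. -/

import Mathlib

open MeasureTheory Filter Topology
open scoped ENNReal ContDiff

namespace Choquard

/-- The Riesz kernel `I_α` on `ℝ^N`. -/
noncomputable def rieszKernel (N : ℕ) (α : ℝ) (x : EuclideanSpace ℝ (Fin N)) : ℝ :=
  Real.Gamma ((N - α) / 2) /
    (Real.Gamma (α / 2) * Real.pi ^ ((N : ℝ) / 2) * 2 ^ α * ‖x‖ ^ ((N : ℝ) - α))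

/-- The optimal constant `C_α` of the weighted Hardy–Littlewood–Sobolev inequality
`∫ |I_{α/2} * f|² ≤ C_α ∫ |f(x)|² |x|^α dx` on `ℝ^N`. -/
noncomputable def hlsConst (N : ℕ) (α : ℝ) : ℝ :=
  1 / 2 ^ α * (Real.Gamma ((N - α) / 4) / Real.Gamma ((N + α) / 4)) ^ 2

/-- `φ ∈ C_c^∞(Ω)`. -/
structure IsTestFunction {N : ℕ} (Ω : Set (EuclideanSpace ℝ (Fin N)))
    (φ : EuclideanSpace ℝ (Fin N) → ℝ) : Prop where
  contDiff : ContDiff ℝ ∞ φ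
  hasCompactSupport : HasCompactSupport φ
  tsupport_subset : tsupport φ ⊆ Ω

/-- `G` is the weak gradient of `u` in the open set `Ω`. -/
structure IsWeakGradient {N : ℕ} (Ω : Set (EuclideanSpace ℝ (Fin N)))
    (u : EuclideanSpace ℝ (Fin N) → ℝ)
    (G : EuclideanSpace ℝ (Fin N) → EuclideanSpace ℝ (Fin N)) : Prop where
  locallyIntegrableOn : LocallyIntegrableOn u Ω volume
  locallyIntegrableOn_grad : LocallyIntegrableOn G Ω volume
  integral_eq : ∀ ψ : EuclideanSpace ℝ (Fin N) → ℝ, IsTestFunction Ω ψ →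
    ∫ x in Ω, u x • gradient ψ x = - ∫ x in Ω, ψ x • G x

/-- `u ∈ H¹_loc(Ω)`, with weak gradient `Du`. -/
structure IsH1Loc {N : ℕ} (Ω : Set (EuclideanSpace ℝ (Fin N)))
    (u : EuclideanSpace ℝ (Fin N) → ℝ)
    (Du : EuclideanSpace ℝ (Fin N) → EuclideanSpace ℝ (Fin N)) : Prop where
  isWeakGradient : IsWeakGradient Ω u Du
  memLp : ∀ K : Set (EuclideanSpace ℝ (Fin N)), IsCompact K → K ⊆ Ω →
    MemLp u 2 (volume.restrict K)
  memLp_grad : ∀ K : Set (EuclideanSpace ℝ (Fin N)), IsCompact K → K ⊆ Ω →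
    MemLp Du 2 (volume.restrict K)

/-- `u ∈ H¹(Ω)`, with weak gradient `Du`. -/
structure IsH1 {N : ℕ} (Ω : Set (EuclideanSpace ℝ (Fin N)))
    (u : EuclideanSpace ℝ (Fin N) → ℝ)
    (Du : EuclideanSpace ℝ (Fin N) → EuclideanSpace ℝ (Fin N)) : Prop where
  isWeakGradient : IsWeakGradient Ω u Du
  memLp : MemLp u 2 (volume.restrict Ω)
  memLp_grad : MemLp Du 2 (volume.restrict Ω)

/-- The squared norm `‖u‖_ε² = ∫ ε² |∇u|² + V |u|²` of a function `u` on `ℝ^N` with gradient `G`,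
as an element of `[0, ∞]`. -/
noncomputable def energy {N : ℕ} (ε : ℝ) (V : EuclideanSpace ℝ (Fin N) → ℝ)
    (u : EuclideanSpace ℝ (Fin N) → ℝ)
    (G : EuclideanSpace ℝ (Fin N) → EuclideanSpace ℝ (Fin N)) : ℝ≥0∞ :=
  ∫⁻ x, ENNReal.ofReal (ε ^ 2 * ‖G x‖ ^ 2 + V x * u x ^ 2)

/-- `u ∈ H¹_{V,0}(Ω)`, with weak gradient `G`. The completion of `C_c^∞(Ω)` for the norm `‖·‖_ε`,
realized as a space of functions on `ℝ^N` (vanishing almost everywhere outside `Ω`): for `V ≥ 0`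
continuous and not identically zero, a `‖·‖_ε`-Cauchy sequence of test functions converges in
`L²_loc(ℝ^N)`, and its limit determines its class in the completion. -/
structure IsH1V0 {N : ℕ} (ε : ℝ) (V : EuclideanSpace ℝ (Fin N) → ℝ)
    (Ω : Set (EuclideanSpace ℝ (Fin N))) (u : EuclideanSpace ℝ (Fin N) → ℝ)
    (G : EuclideanSpace ℝ (Fin N) → EuclideanSpace ℝ (Fin N)) : Prop where
  isWeakGradient : IsWeakGradient Set.univ u G
  exists_approx : ∃ φ : ℕ → EuclideanSpace ℝ (Fin N) → ℝ,
    (∀ n, IsTestFunction Ω (φ n)) ∧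
    (∀ K : Set (EuclideanSpace ℝ (Fin N)), IsCompact K →
      Tendsto (fun n => ∫⁻ x in K, ENNReal.ofReal ((φ n x - u x) ^ 2)) atTop (𝓝 0)) ∧
    Tendsto (fun n => energy ε V (fun x => φ n x - u x) (fun x => gradient (φ n) x - G x))
      atTop (𝓝 0)

/-- The assumption `(H₂)` on the penalization potential `H = H_ε`. -/
def HypH2 {N : ℕ} (α p ε : ℝ) (V H : EuclideanSpace ℝ (Fin N) → ℝ) : Prop :=
  ∃ κ : ℝ, 0 < κ ∧ hlsConst N α * p * κ < 1 ∧
    ∀ (φ : EuclideanSpace ℝ (Fin N) → ℝ)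
      (G : EuclideanSpace ℝ (Fin N) → EuclideanSpace ℝ (Fin N)),
      IsH1V0 ε V Set.univ φ G →
      ENNReal.ofReal (1 / ε ^ α) * ∫⁻ x, ENNReal.ofReal ((H x * φ x) ^ 2 * ‖x‖ ^ α) ≤
        ENNReal.ofReal κ * energy ε V φ G

/-- `u`, with weak gradient `Du`, satisfies `-ε² Δu + V u ≤ p ε^{-α} (I_α * H u) H` weakly
in `Ω`. -/
def IsWeakSubsolution {N : ℕ} (α p ε : ℝ) (V H : EuclideanSpace ℝ (Fin N) → ℝ)
    (Ω : Set (EuclideanSpace ℝ (Fin N))) (u : EuclideanSpace ℝ (Fin N) → ℝ)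
    (Du : EuclideanSpace ℝ (Fin N) → EuclideanSpace ℝ (Fin N)) : Prop :=
  ∀ (φ : EuclideanSpace ℝ (Fin N) → ℝ)
    (Dφ : EuclideanSpace ℝ (Fin N) → EuclideanSpace ℝ (Fin N)),
    IsH1 Ω φ Dφ → HasCompactSupport φ → tsupport φ ⊆ Ω → (∀ x, 0 ≤ φ x) →
    ∫ x in Ω, (ε ^ 2 * inner ℝ (Du x) (Dφ x) + V x * u x * φ x) ≤
      p / ε ^ α * ∫ x in Ω, ∫ y in Ω, rieszKernel N α (x - y) * (H y * u y) * (H x * φ x)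

end Choquard

/-!
Write `v` for the positive part of `u`, extended by zero, with weak gradient `∇v`. Formally one
tests the inequality with `v` itself: since `u ≤ v`, since `∇u = ∇v` on `{u > 0}`, and since the
Riesz kernel is positive,
`‖v‖_ε² ≤ p ε^{-α} ∬ I_α(x - y) (H v)(y) (H v)(x) ≤ p C_α ε^{-α} ∫ (H v)² |x|^α ≤ p C_α κ ‖v‖_ε²`,
by the weighted Hardy–Littlewood–Sobolev inequality and `(H₂)`. As `p C_α κ < 1` and `‖v‖_ε` is
finite, `‖v‖_ε = 0`; then `v` is constant, and it vanishes where `V > 0`, so `v = 0`.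

The Hardy–Littlewood–Sobolev inequality with its optimal constant
(`Choquard.lintegral_lintegral_rieszKernel_le`) is the Schur test with weight `|x|^{(N+α)/2}`. The
constant comes out because the Riesz potential of `|x|^{-(N+α)/2}` is `C_α |x|^{-(N-α)/2}`
(`Choquard.lintegral_rieszKernel_mul_rpow`), which follows from the formula for the convolution of
two powers (`Choquard.lintegral_norm_rpow_mul_norm_rpow`): each power is a superposition of
Gaussians, whose convolutions are explicit, and a beta integral remains.

Since `v` need not have compact support in `Ω`, the test function used is `w = a(v) b(φ_m)`, where
`φ_m` are test functions in `Ω` converging to `v`, `a` is a bounded truncation of the identity and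
`b` is a nondecreasing cut-off vanishing on `(-∞, 0]` (`Choquard.IsWeakSubsolution.lintegral_le`).
Letting first `m → ∞` and then `a(t) → t`, `b → 1_{(0, ∞)}`, Fatou's lemma gives the formal
inequality (`Choquard.IsWeakSubsolution.energy_le`).

The facts on weak gradients that this needs are obtained without mollifying `u`, because `v` comes
with an approximating sequence. In the product and chain rules one passes to the limit along
`φ_m`. The identity `∇u = ∇v` on `{u > 0}` (`Choquard.IsH1Loc.ae_grad_eq_grad_posPart`) results from
comparing the weak gradients of `v u` and `v v`, which are the same function; that `∇v = 0` on
`{v = 0}` (`Choquard.IsApproxSeq.ae_grad_eq_zero`) results from the chain rule for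
`arctan (c t) / c` as `c → ∞`.
-/

namespace Choquard

/-! ### Riesz potentials of powers -/

theorem lintegral_rpow_mul_exp_neg_mul_Ioi {a r : ℝ} (ha : 0 < a) (hr : 0 < r) :
    ∫⁻ t in Set.Ioi (0 : ℝ), ENNReal.ofReal (t ^ (a - 1) * Real.exp (-(r * t))) =
      ENNReal.ofReal (r ^ (-a) * Real.Gamma a) := by
  have h := Real.integral_rpow_mul_exp_neg_mul_Ioi ha hr
  have hpos : 0 < (1 / r) ^ a * Real.Gamma a :=
    mul_pos (Real.rpow_pos_of_pos (by positivity) _) (Real.Gamma_pos_of_pos ha)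
  have hint : IntegrableOn (fun t : ℝ => t ^ (a - 1) * Real.exp (-(r * t))) (Set.Ioi 0) := by
    by_contra hn
    rw [integral_undef hn] at h
    exact hpos.ne h
  rw [← ofReal_integral_eq_lintegral_ofReal hint, h, one_div, Real.inv_rpow hr.le,
    Real.rpow_neg hr.le]
  filter_upwards [ae_restrict_mem measurableSet_Ioi] with t ht
  have : (0 : ℝ) < t := ht
  positivity

theorem lintegral_Ioi_eq_mul_lintegral_comp_mul_left {t : ℝ} (ht : 0 < t) (g : ℝ → ℝ≥0∞) :
    ∫⁻ s in Set.Ioi (0 : ℝ), g s = ∫⁻ σ in Set.Ioi (0 : ℝ), ENNReal.ofReal t * g (t * σ) := by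
  have h := lintegral_image_eq_lintegral_abs_deriv_mul (s := Set.Ioi (0 : ℝ))
    (f := fun σ => t * σ) (f' := fun _ => t) measurableSet_Ioi
    (fun x _ => by simpa using ((hasDerivAt_id x).const_mul t).hasDerivWithinAt)
    (mul_right_injective₀ ht.ne').injOn g
  rw [Set.image_mul_left_Ioi ht, mul_zero] at h
  simpa [abs_of_pos ht] using h

/-- The beta integral over `(0, ∞)`, obtained from the Gamma integral by Tonelli's theorem. -/
theorem lintegral_rpow_mul_one_add_rpow {p q : ℝ} (hp : 0 < p) (hq : 0 < q) :
    ∫⁻ σ in Set.Ioi (0 : ℝ), ENNReal.ofReal (σ ^ (p - 1) * (1 + σ) ^ (-(p + q))) =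
      ENNReal.ofReal (Real.Gamma p * Real.Gamma q / Real.Gamma (p + q)) := by
  have hG := Real.Gamma_pos_of_pos (add_pos hp hq)
  have hGp := Real.Gamma_pos_of_pos hp
  -- `Γ(p + q) (1 + σ) ^ (-(p + q))` is itself a Gamma integral, in a new variable `t`
  have key : ENNReal.ofReal (Real.Gamma (p + q)) *
      ∫⁻ σ in Set.Ioi (0 : ℝ), ENNReal.ofReal (σ ^ (p - 1) * (1 + σ) ^ (-(p + q))) =
      ENNReal.ofReal (Real.Gamma p * Real.Gamma q) := by
    calc _ = ∫⁻ σ in Set.Ioi (0 : ℝ), ∫⁻ t in Set.Ioi (0 : ℝ), ENNReal.ofReal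
          (σ ^ (p - 1) * (t ^ (p + q - 1) * Real.exp (-((1 + σ) * t)))) := by
          rw [← lintegral_const_mul _ (by fun_prop)]
          refine setLIntegral_congr_fun measurableSet_Ioi fun σ hσ => ?_
          have hσ' : (0 : ℝ) < σ := hσ
          simp_rw [ENNReal.ofReal_mul (Real.rpow_nonneg hσ'.le (p - 1))]
          rw [lintegral_const_mul _ (by fun_prop),
            lintegral_rpow_mul_exp_neg_mul_Ioi (add_pos hp hq) (by positivity),
            ENNReal.ofReal_mul (by positivity)]
          ring
      _ = ∫⁻ t in Set.Ioi (0 : ℝ), ∫⁻ σ in Set.Ioi (0 : ℝ), ENNReal.ofReal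
          (σ ^ (p - 1) * (t ^ (p + q - 1) * Real.exp (-((1 + σ) * t)))) := by
          rw [lintegral_lintegral_swap]
          fun_prop
      _ = ∫⁻ t in Set.Ioi (0 : ℝ), ENNReal.ofReal (Real.Gamma p) *
            ENNReal.ofReal (t ^ (q - 1) * Real.exp (-(1 * t))) := by
          refine setLIntegral_congr_fun measurableSet_Ioi fun t ht => ?_
          have ht' : (0 : ℝ) < t := ht
          have h1 : ∀ σ : ℝ, σ ^ (p - 1) * (t ^ (p + q - 1) * Real.exp (-((1 + σ) * t))) =
              (t ^ (p + q - 1) * Real.exp (-(1 * t))) *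
                (σ ^ (p - 1) * Real.exp (-(t * σ))) := fun σ => by
            rw [show -((1 + σ) * t) = -(1 * t) + -(t * σ) by ring, Real.exp_add]; ring
          simp only [h1]
          simp_rw [ENNReal.ofReal_mul (show 0 ≤ t ^ (p + q - 1) * Real.exp (-(1 * t)) by positivity)]
          rw [lintegral_const_mul _ (by fun_prop), lintegral_rpow_mul_exp_neg_mul_Ioi hp ht',
            ← ENNReal.ofReal_mul (by positivity), ← ENNReal.ofReal_mul hGp.le]
          congr 1
          rw [show q - 1 = (p + q - 1) + (-p) by ring, Real.rpow_add ht']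
          ring
      _ = _ := by
          rw [lintegral_const_mul _ (by fun_prop), lintegral_rpow_mul_exp_neg_mul_Ioi hq one_pos,
            ← ENNReal.ofReal_mul hGp.le, Real.one_rpow, one_mul]
  rw [← ENNReal.mul_right_inj (by simpa using hG) ENNReal.ofReal_ne_top, key,
    ← ENNReal.ofReal_mul hG.le]
  congr 1
  field_simp

theorem lintegral_exp_neg_mul_norm_sub_sq {N : ℕ} {s t : ℝ} (hs : 0 < s) (ht : 0 < t)
    (x : EuclideanSpace ℝ (Fin N)) :
    ∫⁻ y : EuclideanSpace ℝ (Fin N),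
        ENNReal.ofReal (Real.exp (-(s * ‖x - y‖ ^ 2)) * Real.exp (-(t * ‖y‖ ^ 2))) =
      ENNReal.ofReal ((Real.pi / (s + t)) ^ ((N : ℝ) / 2) *
        Real.exp (-(s * t / (s + t) * ‖x‖ ^ 2))) := by
  have hst : 0 < s + t := by positivity
  have h := GaussianFourier.integral_rexp_neg_mul_sq_norm (V := EuclideanSpace ℝ (Fin N)) hst
  rw [finrank_euclideanSpace_fin] at h
  have hpos : 0 < (Real.pi / (s + t)) ^ ((N : ℝ) / 2) := by positivity
  have hint : Integrable fun v : EuclideanSpace ℝ (Fin N) => Real.exp (-(s + t) * ‖v‖ ^ 2) := by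
    by_contra hn
    rw [integral_undef hn] at h
    exact hpos.ne h
  -- completing the square
  have hsq : ∀ y : EuclideanSpace ℝ (Fin N),
      Real.exp (-(s * ‖x - y‖ ^ 2)) * Real.exp (-(t * ‖y‖ ^ 2)) =
        Real.exp (-(s * t / (s + t) * ‖x‖ ^ 2)) *
          Real.exp (-(s + t) * ‖y - (s / (s + t)) • x‖ ^ 2) := fun y => by
    rw [← Real.exp_add, ← Real.exp_add, norm_sub_sq_real, norm_sub_sq_real, norm_smul,
      inner_smul_right, real_inner_comm, Real.norm_of_nonneg (by positivity)]
    congr 1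
    field_simp
    ring
  simp_rw [hsq, ENNReal.ofReal_mul (Real.exp_pos (-(s * t / (s + t) * ‖x‖ ^ 2))).le]
  rw [lintegral_const_mul _ (by fun_prop),
    lintegral_sub_right_eq_self
      (fun v : EuclideanSpace ℝ (Fin N) => ENNReal.ofReal (Real.exp (-(s + t) * ‖v‖ ^ 2))),
    ← ofReal_integral_eq_lintegral_ofReal hint (ae_of_all _ fun _ => (Real.exp_pos _).le), h,
    mul_comm, ENNReal.ofReal_mul hpos.le]

/-- The power `r ^ (-2a)` as a superposition of Gaussians. -/
theorem ofReal_Gamma_mul_rpow {a r : ℝ} (ha : 0 < a) (hr : 0 < r) :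
    ENNReal.ofReal (Real.Gamma a) * ENNReal.ofReal (r ^ (-(2 * a))) =
      ∫⁻ t in Set.Ioi (0 : ℝ), ENNReal.ofReal (t ^ (a - 1) * Real.exp (-(t * r ^ 2))) := by
  have h := lintegral_rpow_mul_exp_neg_mul_Ioi ha (pow_pos hr 2)
  simp_rw [mul_comm (r ^ 2)] at h
  rw [h, ← ENNReal.ofReal_mul (Real.Gamma_pos_of_pos ha).le, mul_comm, ← Real.rpow_natCast,
    ← Real.rpow_mul hr.le]
  norm_num

/-- The convolution of two powers of the norm. -/
theorem lintegral_norm_rpow_mul_norm_rpow {N : ℕ} {a b : ℝ} (ha : 0 < a) (hb : 0 < b)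
    (haN : a < N / 2) (hbN : b < N / 2) (hab : (N : ℝ) / 2 < a + b)
    {x : EuclideanSpace ℝ (Fin N)} (hx : x ≠ 0) :
    ∫⁻ y : EuclideanSpace ℝ (Fin N),
        ENNReal.ofReal (‖x - y‖ ^ (-(2 * a)) * ‖y‖ ^ (-(2 * b))) =
      ENNReal.ofReal (Real.pi ^ ((N : ℝ) / 2) * Real.Gamma (a + b - N / 2) *
        (Real.Gamma (N / 2 - b) * Real.Gamma (N / 2 - a) / Real.Gamma (N - a - b)) /
        (Real.Gamma a * Real.Gamma b) * ‖x‖ ^ (-(2 * (a + b - N / 2)))) := by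
  have hN : 0 < N := by
    have : (0 : ℝ) < N := by linarith
    exact_mod_cast this
  have : Nonempty (Fin N) := ⟨⟨0, hN⟩⟩
  set n : ℝ := (N : ℝ) / 2 with hn
  set c : ℝ := a + b - n with hc
  have hr : 0 < ‖x‖ := norm_pos_iff.2 hx
  have hc0 : 0 < c := by linarith
  have hGa := Real.Gamma_pos_of_pos ha
  have hGb := Real.Gamma_pos_of_pos hb
  have hGc := Real.Gamma_pos_of_pos hc0
  have hpi : 0 < Real.pi ^ n := Real.rpow_pos_of_pos Real.pi_pos _
  have hae : ∀ᵐ y : EuclideanSpace ℝ (Fin N), y ≠ 0 ∧ x - y ≠ 0 := by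
    have h0 : ∀ z : EuclideanSpace ℝ (Fin N), ∀ᵐ y : EuclideanSpace ℝ (Fin N), y ≠ z := fun z => by
      simp [ae_iff]
    filter_upwards [h0 0, h0 x] with y h1 h2 using ⟨h1, sub_ne_zero.2 h2.symm⟩
  have key : ENNReal.ofReal (Real.Gamma a * Real.Gamma b) *
      ∫⁻ y : EuclideanSpace ℝ (Fin N),
        ENNReal.ofReal (‖x - y‖ ^ (-(2 * a)) * ‖y‖ ^ (-(2 * b))) =
      ENNReal.ofReal (Real.pi ^ n * Real.Gamma c *
        (Real.Gamma (n - b) * Real.Gamma (n - a) / Real.Gamma (N - a - b)) *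
          ‖x‖ ^ (-(2 * c))) := by
    calc _ = ∫⁻ y : EuclideanSpace ℝ (Fin N), ∫⁻ t in Set.Ioi (0 : ℝ), ∫⁻ s in Set.Ioi (0 : ℝ),
            ENNReal.ofReal (s ^ (a - 1) * Real.exp (-(s * ‖x - y‖ ^ 2))) *
              ENNReal.ofReal (t ^ (b - 1) * Real.exp (-(t * ‖y‖ ^ 2))) := by
          rw [← lintegral_const_mul' _ _ ENNReal.ofReal_ne_top]
          refine lintegral_congr_ae ?_
          filter_upwards [hae] with y hy
          simp_rw [lintegral_mul_const' _ _ ENNReal.ofReal_ne_top]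
          rw [lintegral_const_mul _ (by fun_prop),
            ← ofReal_Gamma_mul_rpow ha (norm_pos_iff.2 hy.2),
            ← ofReal_Gamma_mul_rpow hb (norm_pos_iff.2 hy.1), ENNReal.ofReal_mul hGa.le,
            ENNReal.ofReal_mul (Real.rpow_nonneg (norm_nonneg _) _)]
          ring
      _ = ∫⁻ t in Set.Ioi (0 : ℝ), ∫⁻ s in Set.Ioi (0 : ℝ), ∫⁻ y : EuclideanSpace ℝ (Fin N),
            ENNReal.ofReal (s ^ (a - 1) * Real.exp (-(s * ‖x - y‖ ^ 2))) *
              ENNReal.ofReal (t ^ (b - 1) * Real.exp (-(t * ‖y‖ ^ 2))) := by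
          rw [lintegral_lintegral_swap]
          · refine lintegral_congr fun t => ?_
            rw [lintegral_lintegral_swap]
            fun_prop
          · refine Measurable.aemeasurable ?_
            refine Measurable.lintegral_prod_right'
              (f := fun q : (EuclideanSpace ℝ (Fin N) × ℝ) × ℝ =>
                ENNReal.ofReal (q.2 ^ (a - 1) * Real.exp (-(q.2 * ‖x - q.1.1‖ ^ 2))) *
              ENNReal.ofReal (q.1.2 ^ (b - 1) * Real.exp (-(q.1.2 * ‖q.1.1‖ ^ 2)))) ?_
            fun_prop
      _ = ∫⁻ t in Set.Ioi (0 : ℝ), ∫⁻ s in Set.Ioi (0 : ℝ),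
            ENNReal.ofReal (s ^ (a - 1) * t ^ (b - 1) * ((Real.pi / (s + t)) ^ n *
              Real.exp (-(s * t / (s + t) * ‖x‖ ^ 2)))) := by
          refine setLIntegral_congr_fun measurableSet_Ioi fun t ht => ?_
          refine setLIntegral_congr_fun measurableSet_Ioi fun s hs => ?_
          have ht' : (0 : ℝ) < t := ht
          have hs' : (0 : ℝ) < s := hs
          have hst : 0 ≤ s ^ (a - 1) * t ^ (b - 1) := by positivity
          rw [ENNReal.ofReal_mul hst, ← lintegral_exp_neg_mul_norm_sub_sq hs' ht' x,
            ← lintegral_const_mul _ (by fun_prop)]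
          refine lintegral_congr fun y => ?_
          rw [← ENNReal.ofReal_mul hst, ← ENNReal.ofReal_mul (by positivity)]
          congr 1
          ring
      _ = ∫⁻ t in Set.Ioi (0 : ℝ), ∫⁻ σ in Set.Ioi (0 : ℝ),
            ENNReal.ofReal (Real.pi ^ n * (σ ^ (a - 1) * (1 + σ) ^ (-n)) *
              (t ^ (c - 1) * Real.exp (-((σ / (1 + σ) * ‖x‖ ^ 2) * t)))) := by
          refine setLIntegral_congr_fun measurableSet_Ioi fun t ht => ?_
          have ht' : (0 : ℝ) < t := ht
          -- the substitution `s = t σ` separates the two variables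
          rw [lintegral_Ioi_eq_mul_lintegral_comp_mul_left ht']
          refine setLIntegral_congr_fun measurableSet_Ioi fun σ hσ => ?_
          have hσ' : (0 : ℝ) < σ := hσ
          have h1 : t * σ + t = t * (1 + σ) := by ring
          have h2 : t * σ * t / (t * (1 + σ)) * ‖x‖ ^ 2 = σ / (1 + σ) * ‖x‖ ^ 2 * t := by
            field_simp
          have h3 : t ^ (c - 1) = t * t ^ (a - 1) * t ^ (b - 1) * t ^ (-n) := by
            rw [show c - 1 = 1 + (a - 1) + (b - 1) + (-n) by rw [hc]; ring, Real.rpow_add ht',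
              Real.rpow_add ht', Real.rpow_add ht', Real.rpow_one]
          rw [← ENNReal.ofReal_mul ht'.le, h1, h2, h3, Real.mul_rpow ht'.le hσ'.le,
            Real.div_rpow Real.pi_pos.le (by positivity), Real.mul_rpow ht'.le (by positivity),
            Real.rpow_neg ht'.le, Real.rpow_neg (show 0 ≤ 1 + σ by positivity)]
          congr 1
          field_simp
      _ = ∫⁻ σ in Set.Ioi (0 : ℝ), ∫⁻ t in Set.Ioi (0 : ℝ),
            ENNReal.ofReal (Real.pi ^ n * (σ ^ (a - 1) * (1 + σ) ^ (-n)) *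
              (t ^ (c - 1) * Real.exp (-((σ / (1 + σ) * ‖x‖ ^ 2) * t)))) := by
          rw [lintegral_lintegral_swap]
          fun_prop
      _ = ∫⁻ σ in Set.Ioi (0 : ℝ), ENNReal.ofReal (Real.pi ^ n * Real.Gamma c * ‖x‖ ^ (-(2 * c))) *
            ENNReal.ofReal (σ ^ (n - b - 1) * (1 + σ) ^ (-(n - b + (n - a)))) := by
          refine setLIntegral_congr_fun measurableSet_Ioi fun σ hσ => ?_
          have hσ' : (0 : ℝ) < σ := hσ
          have h0 : 0 ≤ Real.pi ^ n * (σ ^ (a - 1) * (1 + σ) ^ (-n)) := by positivity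
          simp_rw [ENNReal.ofReal_mul h0]
          rw [lintegral_const_mul _ (by fun_prop),
            lintegral_rpow_mul_exp_neg_mul_Ioi hc0 (by positivity), ← ENNReal.ofReal_mul h0,
            ← ENNReal.ofReal_mul (by positivity)]
          congr 1
          rw [Real.mul_rpow (by positivity) (by positivity), Real.div_rpow hσ'.le (by positivity),
            ← Real.rpow_natCast ‖x‖, ← Real.rpow_mul hr.le,
            show n - b - 1 = (a - 1) + (-c) by rw [hc]; ring,
            show -(n - b + (n - a)) = (-n) - (-c) by rw [hc]; ring, Real.rpow_add hσ',
            Real.rpow_sub (by positivity : 0 < 1 + σ)]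
          have : ((2 : ℕ) : ℝ) * -c = -(2 * c) := by push_cast; ring
          rw [this]
          ring
      _ = _ := by
          rw [lintegral_const_mul _ (by fun_prop),
            lintegral_rpow_mul_one_add_rpow (by linarith) (by linarith),
            ← ENNReal.ofReal_mul (by positivity),
            show n - b + (n - a) = N - a - b by rw [hn]; ring]
          congr 1
          ring
  have hGab : 0 < Real.Gamma a * Real.Gamma b := mul_pos hGa hGb
  rw [← ENNReal.mul_right_inj (by simpa using hGab) ENNReal.ofReal_ne_top, key,
    ← ENNReal.ofReal_mul hGab.le]
  congr 1
  field_simp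

/-! ### The weighted Hardy–Littlewood–Sobolev inequality -/

theorem rieszKernel_eq_mul_rpow {N : ℕ} {α : ℝ} (x : EuclideanSpace ℝ (Fin N)) :
    rieszKernel N α x = Real.Gamma ((N - α) / 2) /
      (Real.Gamma (α / 2) * Real.pi ^ ((N : ℝ) / 2) * 2 ^ α) * ‖x‖ ^ (-((N : ℝ) - α)) := by
  rw [rieszKernel, Real.rpow_neg (norm_nonneg _)]
  ring

theorem rieszKernel_nonneg {N : ℕ} {α : ℝ} (hα : 0 < α) (hαN : α < N)
    (x : EuclideanSpace ℝ (Fin N)) : 0 ≤ rieszKernel N α x := by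
  have h1 := Real.Gamma_pos_of_pos (show 0 < (N - α) / 2 by linarith)
  have h2 := Real.Gamma_pos_of_pos (show 0 < α / 2 by linarith)
  have := Real.pi_pos
  unfold rieszKernel
  positivity

theorem rieszKernel_sub_comm {N : ℕ} {α : ℝ} (x y : EuclideanSpace ℝ (Fin N)) :
    rieszKernel N α (x - y) = rieszKernel N α (y - x) := by
  simp only [rieszKernel, norm_sub_rev]

theorem measurable_rieszKernel {N : ℕ} {α : ℝ} : Measurable (rieszKernel N α) := by
  unfold rieszKernel
  fun_prop

theorem hlsConst_nonneg (N : ℕ) (α : ℝ) : 0 ≤ hlsConst N α := by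
  unfold hlsConst
  positivity

/-- The power `|y|^{-(N+α)/2}` is, up to the constant `C_α` and the weight `|x|^α`, reproduced by
the Riesz potential: this is what makes the Schur test give the optimal constant. -/
theorem lintegral_rieszKernel_mul_rpow {N : ℕ} {α : ℝ} (hα : 0 < α) (hαN : α < N)
    {x : EuclideanSpace ℝ (Fin N)} (hx : x ≠ 0) :
    ∫⁻ y : EuclideanSpace ℝ (Fin N),
        ENNReal.ofReal (rieszKernel N α (x - y) * ‖y‖ ^ (-((N + α) / 2))) =
      ENNReal.ofReal (hlsConst N α * ‖x‖ ^ (-((N - α) / 2))) := by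
  have h := lintegral_norm_rpow_mul_norm_rpow (N := N) (a := (N - α) / 2) (b := (N + α) / 4)
    (by linarith) (by linarith) (by linarith) (by linarith) (by linarith) hx
  have h1 := Real.Gamma_pos_of_pos (show 0 < (N - α) / 2 by linarith)
  have h2 := Real.Gamma_pos_of_pos (show 0 < α / 2 by linarith)
  have h3 := Real.Gamma_pos_of_pos (show 0 < (N + α) / 4 by linarith)
  have h4 := Real.pi_pos
  have hA : 0 ≤ Real.Gamma ((N - α) / 2) /
      (Real.Gamma (α / 2) * Real.pi ^ ((N : ℝ) / 2) * 2 ^ α) := by positivity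
  simp_rw [rieszKernel_eq_mul_rpow, mul_assoc (_ / _), ENNReal.ofReal_mul hA]
  rw [lintegral_const_mul' _ _ ENNReal.ofReal_ne_top]
  rw [show 2 * (((N : ℝ) - α) / 2) = N - α by ring,
    show 2 * (((N : ℝ) + α) / 4) = (N + α) / 2 by ring,
    show 2 * (((N : ℝ) - α) / 2 + (N + α) / 4 - N / 2) = (N - α) / 2 by ring,
    show ((N : ℝ) - α) / 2 + (N + α) / 4 - N / 2 = (N - α) / 4 by ring,
    show (N : ℝ) / 2 - (N + α) / 4 = (N - α) / 4 by ring,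
    show (N : ℝ) / 2 - (N - α) / 2 = α / 2 by ring,
    show (N : ℝ) - (N - α) / 2 - (N + α) / 4 = (N + α) / 4 by ring] at h
  rw [h, ← ENNReal.ofReal_mul hA, hlsConst]
  congr 1
  field_simp

/-- The weighted Hardy–Littlewood–Sobolev inequality with its optimal constant, in quadratic form:
the Schur test with the weight `|x|^{(N+α)/2}`. -/
theorem lintegral_lintegral_rieszKernel_le {N : ℕ} {α : ℝ} (hα : 0 < α) (hαN : α < N)
    {f : EuclideanSpace ℝ (Fin N) → ℝ} (hf : AEMeasurable f) :
    ∫⁻ x, ∫⁻ y, ENNReal.ofReal (rieszKernel N α (x - y) * (f y * f x)) ≤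
      ENNReal.ofReal (hlsConst N α) * ∫⁻ x, ENNReal.ofReal (f x ^ 2 * ‖x‖ ^ α) := by
  have hN : 0 < N := by
    have : (0 : ℝ) < N := by linarith
    exact_mod_cast this
  have : Nonempty (Fin N) := ⟨⟨0, hN⟩⟩
  have hne : ∀ᵐ y : EuclideanSpace ℝ (Fin N), y ≠ 0 := by simp [ae_iff]
  have hK := measurable_rieszKernel (N := N) (α := α)
  set ρ : EuclideanSpace ℝ (Fin N) → ℝ := fun x => ‖x‖ ^ (((N : ℝ) + α) / 2) with hρ
  have hρm : Measurable ρ := by fun_prop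
  set A : EuclideanSpace ℝ (Fin N) → EuclideanSpace ℝ (Fin N) → ℝ≥0∞ := fun x y =>
    ENNReal.ofReal (rieszKernel N α (x - y) * (2⁻¹ * (f x ^ 2 * ρ x) * (ρ y)⁻¹)) with hA
  have hAint : ∫⁻ x, ∫⁻ y, A x y =
      2⁻¹ * (ENNReal.ofReal (hlsConst N α) * ∫⁻ x, ENNReal.ofReal (f x ^ 2 * ‖x‖ ^ α)) := by
    rw [← lintegral_const_mul' _ _ ENNReal.ofReal_ne_top, ← lintegral_const_mul' _ _ (by simp)]
    refine lintegral_congr_ae ?_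
    filter_upwards [hne] with x hx
    have hx0 : 0 < ‖x‖ := norm_pos_iff.2 hx
    have h0 : 0 ≤ 2⁻¹ * (f x ^ 2 * ρ x) := by positivity
    have h1 : ∀ y, A x y = ENNReal.ofReal (2⁻¹ * (f x ^ 2 * ρ x)) *
        ENNReal.ofReal (rieszKernel N α (x - y) * ‖y‖ ^ (-(((N : ℝ) + α) / 2))) := fun y => by
      rw [← ENNReal.ofReal_mul h0, Real.rpow_neg (norm_nonneg _)]
      simp only [hA, hρ]
      congr 1
      ring
    simp_rw [h1]
    rw [lintegral_const_mul' _ _ ENNReal.ofReal_ne_top, lintegral_rieszKernel_mul_rpow hα hαN hx,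
      show (2⁻¹ : ℝ≥0∞) = ENNReal.ofReal 2⁻¹ by
        rw [ENNReal.ofReal_inv_of_pos two_pos]; simp,
      ← ENNReal.ofReal_mul h0, ← ENNReal.ofReal_mul (hlsConst_nonneg N α),
      ← ENNReal.ofReal_mul (by norm_num)]
    congr 1
    rw [show α = ((N : ℝ) + α) / 2 + -((N - α) / 2) by ring, Real.rpow_add hx0]
    simp only [hρ]
    ring_nf
  have hswap : ∫⁻ x, ∫⁻ y, A y x = ∫⁻ x, ∫⁻ y, A x y := by
    rw [lintegral_lintegral_swap]
    have hf1 : AEMeasurable (fun q : EuclideanSpace ℝ (Fin N) × EuclideanSpace ℝ (Fin N) => f q.2)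
        (volume.prod volume) := hf.comp_snd
    refine AEMeasurable.ennreal_ofReal ?_
    exact AEMeasurable.mul (by fun_prop) (by fun_prop)
  calc ∫⁻ x, ∫⁻ y, ENNReal.ofReal (rieszKernel N α (x - y) * (f y * f x))
      ≤ ∫⁻ x, ∫⁻ y, (A x y + A y x) := by
        refine lintegral_mono_ae ?_
        filter_upwards [hne] with x hx
        refine lintegral_mono_ae ?_
        filter_upwards [hne] with y hy
        have hx0 : 0 < ρ x := Real.rpow_pos_of_pos (norm_pos_iff.2 hx) _
        have hy0 : 0 < ρ y := Real.rpow_pos_of_pos (norm_pos_iff.2 hy) _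
        have hk := rieszKernel_nonneg hα hαN (x - y)
        simp only [hA]
        rw [rieszKernel_sub_comm y x, ← ENNReal.ofReal_add (by positivity) (by positivity),
          ← mul_add]
        refine ENNReal.ofReal_le_ofReal (mul_le_mul_of_nonneg_left ?_ hk)
        -- Young's inequality, from the square of `f x ρ x - f y ρ y`
        have h := div_nonneg (sq_nonneg (f x * ρ x - f y * ρ y))
          (show 0 ≤ 2 * (ρ x * ρ y) by positivity)
        have h2 : (f x * ρ x - f y * ρ y) ^ 2 / (2 * (ρ x * ρ y)) =
            2⁻¹ * (f x ^ 2 * ρ x) * (ρ y)⁻¹ + 2⁻¹ * (f y ^ 2 * ρ y) * (ρ x)⁻¹ - f y * f x := by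
          field_simp
          ring
        linarith
    _ = (∫⁻ x, ∫⁻ y, A x y) + ∫⁻ x, ∫⁻ y, A y x := by
        have hm : ∀ x, Measurable fun y => A x y := fun x => by
          simp only [hA]
          fun_prop
        simp_rw [lintegral_add_left (hm _)]
        rw [lintegral_add_left']
        refine AEMeasurable.lintegral_prod_right'
          (f := fun q : EuclideanSpace ℝ (Fin N) × EuclideanSpace ℝ (Fin N) => A q.1 q.2) ?_
        have hf1 : AEMeasurable
            (fun q : EuclideanSpace ℝ (Fin N) × EuclideanSpace ℝ (Fin N) => f q.1)
            (volume.prod volume) := hf.comp_fst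
        refine AEMeasurable.ennreal_ofReal ?_
        exact AEMeasurable.mul (by fun_prop) (by fun_prop)
    _ = _ := by
        rw [hswap, hAint, ← add_mul, ENNReal.inv_two_add_inv_two, one_mul]

/-! ### Convergence in `L²` -/

section LTwo

variable {X F : Type*} [MeasurableSpace X] {μ : Measure X} [NormedAddCommGroup F]

theorem eLpNorm_two_sq (f : X → F) : eLpNorm f 2 μ ^ 2 = ∫⁻ x, ‖f x‖ₑ ^ 2 ∂μ := by
  have h := eLpNorm_nnreal_pow_eq_lintegral (f := f) (μ := μ) (p := 2) two_ne_zero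
  simpa using h

theorem tendsto_eLpNorm_two_of_tendsto_lintegral {f : ℕ → X → F}
    (h : Tendsto (fun n => ∫⁻ x, ‖f n x‖ₑ ^ 2 ∂μ) atTop (𝓝 0)) :
    Tendsto (fun n => eLpNorm (f n) 2 μ) atTop (𝓝 0) := by
  have h1 := (ENNReal.continuous_rpow_const (y := (1 / 2 : ℝ))).tendsto 0 |>.comp h
  have h2 : ∀ n, (∫⁻ x, ‖f n x‖ₑ ^ 2 ∂μ) ^ (1 / 2 : ℝ) = eLpNorm (f n) 2 μ := fun n => by
    rw [← eLpNorm_two_sq, ← ENNReal.rpow_natCast, ← ENNReal.rpow_mul]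
    norm_num
  rw [ENNReal.zero_rpow_of_pos (by norm_num)] at h1
  exact h1.congr h2

theorem enorm_sq_eq_ofReal (a : F) : ‖a‖ₑ ^ 2 = ENNReal.ofReal (‖a‖ ^ 2) := by
  rw [← ofReal_norm, ENNReal.ofReal_pow (norm_nonneg _)]

theorem tendsto_eLpNorm_two_of_dominated {f : ℕ → X → F} {g : X → F} {B : X → ℝ}
    (hf : ∀ n, AEStronglyMeasurable (f n) μ) (hg : AEStronglyMeasurable g μ) (hB : MemLp B 2 μ)
    (hfB : ∀ n, ∀ᵐ x ∂μ, ‖f n x - g x‖ ≤ B x)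
    (hlim : ∀ᵐ x ∂μ, Tendsto (fun n => f n x) atTop (𝓝 (g x))) :
    Tendsto (fun n => eLpNorm (f n - g) 2 μ) atTop (𝓝 0) := by
  refine tendsto_eLpNorm_two_of_tendsto_lintegral ?_
  have h := tendsto_lintegral_of_dominated_convergence' (μ := μ)
    (F := fun n x => ‖(f n - g) x‖ₑ ^ 2) (f := fun _ => 0) (fun x => ‖B x‖ₑ ^ 2)
    (fun n => ((hf n).sub hg).enorm.pow_const 2) ?_ ?_ ?_
  · simpa using h
  · intro n
    filter_upwards [hfB n] with x hx
    have : ‖(f n - g) x‖ₑ ≤ ‖B x‖ₑ := by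
      rw [enorm_le_iff_norm_le]
      exact hx.trans (le_abs_self _)
    gcongr
  · rw [← eLpNorm_two_sq]
    exact ENNReal.pow_ne_top hB.eLpNorm_ne_top
  · filter_upwards [hlim] with x hx
    have h1 : Tendsto (fun n => f n x - g x) atTop (𝓝 0) := by simpa using hx.sub_const (g x)
    have h2 := ENNReal.Tendsto.pow (n := 2) h1.enorm
    simpa using h2

theorem memLp_two_of_tendsto {f : ℕ → X → F} {g : X → F} (hf : ∀ n, MemLp (f n) 2 μ)
    (hg : AEStronglyMeasurable g μ)
    (h : Tendsto (fun n => eLpNorm (f n - g) 2 μ) atTop (𝓝 0)) : MemLp g 2 μ := by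
  obtain ⟨n, hn⟩ := (h.eventually (gt_mem_nhds ENNReal.zero_lt_top)).exists
  have h1 : MemLp (f n - g) 2 μ := ⟨(hf n).1.sub hg, hn⟩
  simpa using (hf n).sub h1

variable [NormedSpace ℝ F]

theorem tendsto_integral_smul_of_tendsto_eLpNorm_two {f : ℕ → X → ℝ} {f₀ : X → ℝ}
    {g : ℕ → X → F} {g₀ : X → F} (hf : ∀ n, MemLp (f n) 2 μ) (hf₀ : MemLp f₀ 2 μ)
    (hg : ∀ n, MemLp (g n) 2 μ) (hg₀ : MemLp g₀ 2 μ)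
    (hfl : Tendsto (fun n => eLpNorm (f n - f₀) 2 μ) atTop (𝓝 0))
    (hgl : Tendsto (fun n => eLpNorm (g n - g₀) 2 μ) atTop (𝓝 0)) :
    Tendsto (fun n => ∫ x, f n x • g n x ∂μ) atTop (𝓝 (∫ x, f₀ x • g₀ x ∂μ)) := by
  have hint : ∀ n, Integrable (fun x => f n x • g n x) μ := fun n =>
    memLp_one_iff_integrable.1 ((hg n).smul (hf n))
  have hint₀ : Integrable (fun x => f₀ x • g₀ x) μ :=
    memLp_one_iff_integrable.1 (hg₀.smul hf₀)
  refine tendsto_integral_of_L1' _ hint₀.aestronglyMeasurable (Eventually.of_forall hint) ?_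
  have hlim : Tendsto (fun n => eLpNorm (f n - f₀) 2 μ * eLpNorm (g n - g₀) 2 μ +
      eLpNorm (f n - f₀) 2 μ * eLpNorm g₀ 2 μ + eLpNorm f₀ 2 μ * eLpNorm (g n - g₀) 2 μ)
      atTop (𝓝 0) := by
    have h1 := ENNReal.Tendsto.mul hfl (Or.inr ENNReal.zero_ne_top) hgl (Or.inr ENNReal.zero_ne_top)
    have h2 := ENNReal.Tendsto.mul_const hfl (Or.inr hg₀.eLpNorm_ne_top)
    have h3 := ENNReal.Tendsto.const_mul hgl (Or.inr hf₀.eLpNorm_ne_top)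
    simpa using (h1.add h2).add h3
  refine tendsto_of_tendsto_of_tendsto_of_le_of_le tendsto_const_nhds hlim (fun _ => zero_le)
    fun n => ?_
  have hfs := (hf n).1.sub hf₀.1
  have hgs := (hg n).1.sub hg₀.1
  have hdec : (fun x => f n x • g n x) - (fun x => f₀ x • g₀ x) =
      ((f n - f₀) • (g n - g₀) + (f n - f₀) • g₀) + f₀ • (g n - g₀) := by
    ext x
    simp only [Pi.sub_apply, Pi.add_apply, Pi.smul_apply', smul_sub, sub_smul]
    abel
  simp only
  rw [hdec]
  refine (eLpNorm_add_le ((hfs.smul hgs).add (hfs.smul hg₀.1)) (hf₀.1.smul hgs) le_rfl).trans ?_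
  refine add_le_add ((eLpNorm_add_le (hfs.smul hgs) (hfs.smul hg₀.1) le_rfl).trans ?_)
    (eLpNorm_smul_le_mul_eLpNorm hgs hf₀.1)
  exact add_le_add (eLpNorm_smul_le_mul_eLpNorm hgs hfs) (eLpNorm_smul_le_mul_eLpNorm hg₀.1 hfs)

end LTwo

/-! ### Test functions -/

section TestFunction

variable {N : ℕ} {Ω Ω' : Set (EuclideanSpace ℝ (Fin N))} {φ ψ : EuclideanSpace ℝ (Fin N) → ℝ}

theorem IsTestFunction.mono (h : IsTestFunction Ω φ) (hΩ : Ω ⊆ Ω') : IsTestFunction Ω' φ :=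
  ⟨h.1, h.2, h.3.trans hΩ⟩

theorem IsTestFunction.hasGradientAt (h : IsTestFunction Ω φ) (x : EuclideanSpace ℝ (Fin N)) :
    HasGradientAt φ (gradient φ x) x :=
  (h.contDiff.differentiable (by simp) x).hasGradientAt

theorem IsTestFunction.continuous_gradient (h : IsTestFunction Ω φ) :
    Continuous (gradient φ) := by
  unfold gradient
  exact (LinearIsometryEquiv.continuous _).comp (h.contDiff.continuous_fderiv (by simp))

theorem IsTestFunction.tsupport_gradient_subset (_h : IsTestFunction Ω φ) :
    tsupport (gradient φ) ⊆ tsupport φ := by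
  refine closure_mono (fun x hx => ?_) |>.trans
    ((tsupport_fderiv_subset ℝ (f := φ)).trans subset_rfl)
  rw [Function.mem_support] at hx ⊢
  contrapose! hx
  simp [gradient, hx]

theorem IsTestFunction.hasCompactSupport_gradient (h : IsTestFunction Ω φ) :
    HasCompactSupport (gradient φ) :=
  h.hasCompactSupport.of_isClosed_subset (isClosed_tsupport _) h.tsupport_gradient_subset

theorem IsTestFunction.memLp (h : IsTestFunction Ω φ) (q : ℝ≥0∞)
    (K : Set (EuclideanSpace ℝ (Fin N))) : MemLp φ q (volume.restrict K) :=
  h.contDiff.continuous.memLp_of_hasCompactSupport h.hasCompactSupport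

theorem IsTestFunction.memLp_gradient (h : IsTestFunction Ω φ) (q : ℝ≥0∞)
    (K : Set (EuclideanSpace ℝ (Fin N))) : MemLp (gradient φ) q (volume.restrict K) :=
  h.continuous_gradient.memLp_of_hasCompactSupport h.hasCompactSupport_gradient

theorem IsTestFunction.mul (hφ : IsTestFunction Ω φ) (hψ : IsTestFunction Ω' ψ) :
    IsTestFunction Ω' (fun x => φ x * ψ x) :=
  ⟨hφ.contDiff.mul hψ.contDiff, hψ.hasCompactSupport.mul_left,
    tsupport_mul_subset_right.trans hψ.tsupport_subset⟩

theorem IsTestFunction.gradient_mul (hφ : IsTestFunction Ω φ) (hψ : IsTestFunction Ω' ψ)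
    (x : EuclideanSpace ℝ (Fin N)) :
    gradient (fun x => φ x * ψ x) x = φ x • gradient ψ x + ψ x • gradient φ x := by
  refine HasGradientAt.gradient ?_
  rw [hasGradientAt_iff_hasFDerivAt, map_add, map_smul, map_smul]
  exact (hφ.hasGradientAt x).hasFDerivAt.mul (hψ.hasGradientAt x).hasFDerivAt

theorem IsTestFunction.comp (hφ : IsTestFunction Ω φ) {a : ℝ → ℝ} (ha : ContDiff ℝ ∞ a)
    (ha0 : a 0 = 0) : IsTestFunction Ω (fun x => a (φ x)) :=
  ⟨ha.comp hφ.contDiff, hφ.hasCompactSupport.comp_left ha0,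
    (tsupport_comp_subset ha0 φ).trans hφ.tsupport_subset⟩

theorem IsTestFunction.gradient_comp (hφ : IsTestFunction Ω φ) {a : ℝ → ℝ}
    (ha : ContDiff ℝ ∞ a) (x : EuclideanSpace ℝ (Fin N)) :
    gradient (fun x => a (φ x)) x = deriv a (φ x) • gradient φ x := by
  refine HasGradientAt.gradient ?_
  rw [hasGradientAt_iff_hasFDerivAt, map_smul]
  exact (ha.differentiable (by simp) (φ x)).hasDerivAt.comp_hasFDerivAt x
    (hφ.hasGradientAt x).hasFDerivAt

theorem IsTestFunction.eq_zero_of_notMem (h : IsTestFunction Ω φ) {x : EuclideanSpace ℝ (Fin N)}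
    (hx : x ∉ Ω) : φ x = 0 :=
  image_eq_zero_of_notMem_tsupport fun hx' => hx (h.tsupport_subset hx')

theorem IsTestFunction.gradient_eq_zero_of_notMem_tsupport (h : IsTestFunction Ω φ)
    {x : EuclideanSpace ℝ (Fin N)} (hx : x ∉ tsupport φ) : gradient φ x = 0 :=
  image_eq_zero_of_notMem_tsupport fun hx' => hx (h.tsupport_gradient_subset hx')

theorem IsTestFunction.integral_smul_gradient (hφ : IsTestFunction Ω φ)
    (hψ : IsTestFunction Ω' ψ) :
    ∫ x, φ x • gradient ψ x = - ∫ x, ψ x • gradient φ x := by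
  have hi : ∀ {Ω Ω' : Set (EuclideanSpace ℝ (Fin N))} {φ ψ : EuclideanSpace ℝ (Fin N) → ℝ},
      IsTestFunction Ω φ → IsTestFunction Ω' ψ → Integrable fun x => φ x • gradient ψ x :=
    fun hφ hψ => (hφ.contDiff.continuous.smul hψ.continuous_gradient).integrable_of_hasCompactSupport
      hφ.hasCompactSupport.smul_right
  have hin : ∀ {Ω Ω' : Set (EuclideanSpace ℝ (Fin N))} {φ ψ : EuclideanSpace ℝ (Fin N) → ℝ}
      (y : EuclideanSpace ℝ (Fin N)), IsTestFunction Ω φ → IsTestFunction Ω' ψ →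
      ∀ x, inner ℝ y (φ x • gradient ψ x) = φ x * fderiv ℝ ψ x y := fun y hφ hψ x => by
    rw [inner_smul_right, real_inner_comm, (hψ.hasGradientAt x).fderiv_apply]
  refine ext_inner_left ℝ fun y => ?_
  rw [inner_neg_right, ← integral_inner (hi hφ hψ), ← integral_inner (hi hψ hφ)]
  simp_rw [hin y hφ hψ, hin y hψ hφ]
  rw [integral_mul_fderiv_eq_neg_fderiv_mul_of_integrable]
  · simp_rw [mul_comm]
  · simpa only [hin y hψ hφ, mul_comm] using (hi hψ hφ).const_inner (𝕜 := ℝ) y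
  · simpa only [hin y hφ hψ] using (hi hφ hψ).const_inner (𝕜 := ℝ) y
  · exact (hφ.contDiff.continuous.mul hψ.contDiff.continuous).integrable_of_hasCompactSupport
      hφ.hasCompactSupport.mul_right
  · exact fun x _ => hφ.contDiff.differentiable (by simp) x
  · exact fun x _ => hψ.contDiff.differentiable (by simp) x

end TestFunction

/-! ### Approximation in `H¹_{V,0}(Ω)` -/

section Approx

variable {N : ℕ} {ε : ℝ} {V : EuclideanSpace ℝ (Fin N) → ℝ}
  {Ω : Set (EuclideanSpace ℝ (Fin N))} {v : EuclideanSpace ℝ (Fin N) → ℝ}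
  {G : EuclideanSpace ℝ (Fin N) → EuclideanSpace ℝ (Fin N)}

/-- `φ` is a sequence of test functions in `Ω` converging to `v` in `L²_loc(ℝ^N)` and almost
everywhere, with gradients converging to `G` in `L²(ℝ^N)`. -/
structure IsApproxSeq (Ω : Set (EuclideanSpace ℝ (Fin N))) (v : EuclideanSpace ℝ (Fin N) → ℝ)
    (G : EuclideanSpace ℝ (Fin N) → EuclideanSpace ℝ (Fin N))
    (φ : ℕ → EuclideanSpace ℝ (Fin N) → ℝ) : Prop where
  isTestFunction : ∀ n, IsTestFunction Ω (φ n)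
  aestronglyMeasurable : AEStronglyMeasurable v
  aestronglyMeasurable_grad : AEStronglyMeasurable G
  tendsto_loc : ∀ K : Set (EuclideanSpace ℝ (Fin N)), IsCompact K →
    Tendsto (fun n => eLpNorm (φ n - v) 2 (volume.restrict K)) atTop (𝓝 0)
  tendsto_grad : Tendsto (fun n => eLpNorm (gradient (φ n) - G) 2) atTop (𝓝 0)
  tendsto_ae : ∀ᵐ x, Tendsto (fun n => φ n x) atTop (𝓝 (v x))

/-- A sequence converging in `L²_loc` has a subsequence that converges almost everywhere. -/
theorem exists_subseq_tendsto_ae_of_tendsto_loc {φ : ℕ → EuclideanSpace ℝ (Fin N) → ℝ}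
    (hφ : ∀ n, AEMeasurable (φ n)) (hv : AEMeasurable v)
    (h : ∀ K : Set (EuclideanSpace ℝ (Fin N)), IsCompact K →
      Tendsto (fun n => ∫⁻ x in K, ENNReal.ofReal ((φ n x - v x) ^ 2)) atTop (𝓝 0)) :
    ∃ k : ℕ → ℕ, StrictMono k ∧ ∀ᵐ x, Tendsto (fun n => φ (k n) x) atTop (𝓝 (v x)) := by
  -- along the subsequence the squared distances on the balls of radius `n` are summable
  obtain ⟨k, hk, hkn⟩ := extraction_forall_of_eventually
    (P := fun n m => ∫⁻ x in Metric.closedBall (0 : EuclideanSpace ℝ (Fin N)) n,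
      ENNReal.ofReal ((φ m x - v x) ^ 2) < (2⁻¹ : ℝ≥0∞) ^ n)
    fun n => (h _ (isCompact_closedBall 0 (n : ℝ))).eventually
      (gt_mem_nhds (ENNReal.pow_pos (by simp) n))
  refine ⟨k, hk, ?_⟩
  set f : ℕ → EuclideanSpace ℝ (Fin N) → ℝ≥0∞ := fun n =>
    (Metric.closedBall (0 : EuclideanSpace ℝ (Fin N)) n).indicator
      fun x => ENNReal.ofReal ((φ (k n) x - v x) ^ 2) with hf
  have hfm : ∀ n, AEMeasurable (f n) := fun n =>
    (((hφ _).sub hv).pow_const 2).ennreal_ofReal.indicator Metric.isClosed_closedBall.measurableSet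
  have hsum : ∫⁻ x, ∑' n, f n x ≠ ⊤ := by
    rw [lintegral_tsum hfm]
    refine ne_top_of_le_ne_top (b := ∑' n : ℕ, (2⁻¹ : ℝ≥0∞) ^ n) ?_ (ENNReal.tsum_le_tsum fun n => ?_)
    · rw [ENNReal.tsum_geometric, ENNReal.one_sub_inv_two, inv_inv]
      exact ENNReal.ofNat_ne_top
    · rw [hf, lintegral_indicator Metric.isClosed_closedBall.measurableSet]
      exact (hkn n).le
  filter_upwards [ae_lt_top' (AEMeasurable.tsum hfm) hsum] with x hx
  have h1 := ENNReal.tendsto_atTop_zero_of_tsum_ne_top hx.ne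
  have h2 : Tendsto (fun n => ENNReal.ofReal ((φ (k n) x - v x) ^ 2)) atTop (𝓝 0) := by
    refine h1.congr' ?_
    filter_upwards [eventually_ge_atTop ⌈‖x‖⌉₊] with n hn
    have : x ∈ Metric.closedBall (0 : EuclideanSpace ℝ (Fin N)) n := by
      simpa using (Nat.le_ceil ‖x‖).trans (by exact_mod_cast hn)
    simp [hf, Set.indicator_of_mem this]
  have h3 : Tendsto (fun n => (φ (k n) x - v x) ^ 2) atTop (𝓝 0) := by
    have := (ENNReal.tendsto_toReal ENNReal.zero_ne_top).comp h2
    refine this.congr fun n => ?_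
    simp [ENNReal.toReal_ofReal (sq_nonneg _)]
  have h4 : Tendsto (fun n => |φ (k n) x - v x|) atTop (𝓝 0) := by
    have := (Real.continuous_sqrt.tendsto 0).comp h3
    rw [Real.sqrt_zero] at this
    exact this.congr fun n => Real.sqrt_sq_eq_abs _
  have h5 := (tendsto_zero_iff_abs_tendsto_zero _).2 h4
  simpa using h5.add_const (v x)

theorem IsH1V0.exists_isApproxSeq (hε : 0 < ε) (hV : ∀ x, 0 ≤ V x) (h : IsH1V0 ε V Ω v G) :
    ∃ φ, IsApproxSeq Ω v G φ ∧
      Tendsto (fun n => energy ε V (fun x => φ n x - v x) (fun x => gradient (φ n) x - G x))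
        atTop (𝓝 0) := by
  obtain ⟨φ, hφ, hloc, hen⟩ := h.exists_approx
  have hv := (locallyIntegrableOn_univ.1 h.isWeakGradient.1).aestronglyMeasurable
  have hG := (locallyIntegrableOn_univ.1 h.isWeakGradient.2).aestronglyMeasurable
  obtain ⟨k, hk, hae⟩ := exists_subseq_tendsto_ae_of_tendsto_loc
    (fun n => (hφ n).contDiff.continuous.aemeasurable) hv.aemeasurable hloc
  have hen' := hen.comp hk.tendsto_atTop
  refine ⟨fun n => φ (k n), ⟨fun n => hφ _, hv, hG, fun K hK => ?_, ?_, hae⟩, hen'⟩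
  · refine tendsto_eLpNorm_two_of_tendsto_lintegral ?_
    refine ((hloc K hK).comp hk.tendsto_atTop).congr fun n => lintegral_congr fun x => ?_
    rw [enorm_sq_eq_ofReal]
    simp
  · refine tendsto_eLpNorm_two_of_tendsto_lintegral ?_
    have h1 := ENNReal.Tendsto.const_mul (a := ENNReal.ofReal (ε ^ 2)⁻¹) hen'
      (Or.inr ENNReal.ofReal_ne_top)
    rw [mul_zero] at h1
    refine tendsto_of_tendsto_of_tendsto_of_le_of_le tendsto_const_nhds h1 (fun _ => zero_le)
      fun n => ?_
    simp only [Function.comp_apply, energy]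
    rw [← lintegral_const_mul' _ _ ENNReal.ofReal_ne_top]
    refine lintegral_mono fun x => ?_
    rw [← ENNReal.ofReal_mul (by positivity), enorm_sq_eq_ofReal]
    refine ENNReal.ofReal_le_ofReal ?_
    rw [mul_add, inv_mul_cancel_left₀ (by positivity)]
    have := hV x
    simp only [Pi.sub_apply]
    have : 0 ≤ (ε ^ 2)⁻¹ * (V x * (φ (k n) x - v x) ^ 2) := by positivity
    linarith

theorem energy_lt_top_of_isTestFunction (hVc : Continuous V) {φ : EuclideanSpace ℝ (Fin N) → ℝ}
    (hφ : IsTestFunction Ω φ) : energy ε V φ (gradient φ) < ⊤ := by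
  have hc : Continuous fun x => ε ^ 2 * ‖gradient φ x‖ ^ 2 + V x * φ x ^ 2 :=
    (continuous_const.mul (hφ.continuous_gradient.norm.pow 2)).add
      (hVc.mul (hφ.contDiff.continuous.pow 2))
  have hs : HasCompactSupport fun x => ε ^ 2 * ‖gradient φ x‖ ^ 2 + V x * φ x ^ 2 := by
    refine hφ.hasCompactSupport.mono' fun x hx => ?_
    by_contra hn
    rw [Function.mem_support, hφ.gradient_eq_zero_of_notMem_tsupport hn,
      image_eq_zero_of_notMem_tsupport hn] at hx
    simp at hx
  exact (hc.integrable_of_hasCompactSupport hs).lintegral_lt_top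

theorem IsH1V0.energy_lt_top (hVc : Continuous V) (hV : ∀ x, 0 ≤ V x)
    (h : IsH1V0 ε V Ω v G) : energy ε V v G < ⊤ := by
  obtain ⟨φ, hφ, -, hen⟩ := h.exists_approx
  obtain ⟨n, hn⟩ := (hen.eventually (gt_mem_nhds ENNReal.zero_lt_top)).exists
  have hφn := energy_lt_top_of_isTestFunction (ε := ε) hVc (hφ n)
  have hc : Continuous fun x => 2 * (ε ^ 2 * ‖gradient (φ n) x‖ ^ 2 + V x * φ n x ^ 2) :=
    continuous_const.mul ((continuous_const.mul ((hφ n).continuous_gradient.norm.pow 2)).add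
      (hVc.mul ((hφ n).contDiff.continuous.pow 2)))
  have hle : energy ε V v G ≤ ENNReal.ofReal 2 * energy ε V (φ n) (gradient (φ n)) +
      ENNReal.ofReal 2 * energy ε V (fun x => φ n x - v x) (fun x => gradient (φ n) x - G x) := by
    simp only [energy]
    rw [← lintegral_const_mul' _ _ ENNReal.ofReal_ne_top,
      ← lintegral_const_mul' _ _ ENNReal.ofReal_ne_top]
    simp_rw [← ENNReal.ofReal_mul (zero_le_two : (0 : ℝ) ≤ 2)]
    rw [← lintegral_add_left hc.measurable.ennreal_ofReal]
    refine lintegral_mono fun x => ?_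
    have hx := hV x
    rw [← ENNReal.ofReal_add (by positivity) (by positivity)]
    refine ENNReal.ofReal_le_ofReal ?_
    have h3 : ‖G x‖ ^ 2 ≤ 2 * ‖gradient (φ n) x‖ ^ 2 + 2 * ‖gradient (φ n) x - G x‖ ^ 2 := by
      have h4 : ‖G x‖ ≤ ‖gradient (φ n) x‖ + ‖gradient (φ n) x - G x‖ := by
        have := norm_sub_le (gradient (φ n) x) (gradient (φ n) x - G x)
        simpa using this
      nlinarith [norm_nonneg (G x), sq_nonneg (‖gradient (φ n) x‖ - ‖gradient (φ n) x - G x‖)]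
    have h5 : v x ^ 2 ≤ 2 * φ n x ^ 2 + 2 * (φ n x - v x) ^ 2 := by
      nlinarith [sq_nonneg (2 * φ n x - v x)]
    have h6 := mul_le_mul_of_nonneg_left h3 (sq_nonneg ε)
    have h7 := mul_le_mul_of_nonneg_left h5 hx
    linarith
  exact hle.trans_lt (ENNReal.add_lt_top.2 ⟨ENNReal.mul_lt_top ENNReal.ofReal_lt_top hφn,
    ENNReal.mul_lt_top ENNReal.ofReal_lt_top hn⟩)

variable {φ : ℕ → EuclideanSpace ℝ (Fin N) → ℝ}

theorem IsApproxSeq.memLp (h : IsApproxSeq Ω v G φ) {K : Set (EuclideanSpace ℝ (Fin N))}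
    (hK : IsCompact K) : MemLp v 2 (volume.restrict K) :=
  memLp_two_of_tendsto (fun n => (h.isTestFunction n).memLp 2 K) h.aestronglyMeasurable.restrict
    (h.tendsto_loc K hK)

theorem IsApproxSeq.memLp_grad (h : IsApproxSeq Ω v G φ) : MemLp G 2 :=
  memLp_two_of_tendsto
    (fun n => by simpa using (h.isTestFunction n).memLp_gradient 2 Set.univ)
    h.aestronglyMeasurable_grad h.tendsto_grad

theorem IsApproxSeq.tendsto_grad_restrict (h : IsApproxSeq Ω v G φ)
    (K : Set (EuclideanSpace ℝ (Fin N))) :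
    Tendsto (fun n => eLpNorm (gradient (φ n) - G) 2 (volume.restrict K)) atTop (𝓝 0) :=
  tendsto_of_tendsto_of_tendsto_of_le_of_le tendsto_const_nhds h.tendsto_grad (fun _ => zero_le)
    fun _ => eLpNorm_mono_measure _ Measure.restrict_le_self

end Approx

/-! ### Calculus of weak gradients -/

section Calculus

variable {N : ℕ} {Ω : Set (EuclideanSpace ℝ (Fin N))} {u v : EuclideanSpace ℝ (Fin N) → ℝ}
  {Du G : EuclideanSpace ℝ (Fin N) → EuclideanSpace ℝ (Fin N)}
  {φ : ℕ → EuclideanSpace ℝ (Fin N) → ℝ}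

theorem setIntegral_eq_setIntegral_of_tsupport_subset {F : Type*} [NormedAddCommGroup F]
    [NormedSpace ℝ F] {f : EuclideanSpace ℝ (Fin N) → F} {K : Set (EuclideanSpace ℝ (Fin N))}
    (hKΩ : K ⊆ Ω) (hf : ∀ x, x ∉ K → f x = 0) : ∫ x in Ω, f x = ∫ x in K, f x := by
  rw [setIntegral_eq_integral_of_forall_compl_eq_zero hf,
    setIntegral_eq_integral_of_forall_compl_eq_zero fun x hx => hf x fun h => hx (hKΩ h)]

/-- The fundamental lemma of the calculus of variations, for vector fields on an open set. -/
theorem ae_eq_of_forall_setIntegral_smul_eq (hΩ : IsOpen Ω)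
    {F₁ F₂ : EuclideanSpace ℝ (Fin N) → EuclideanSpace ℝ (Fin N)}
    (h₁ : LocallyIntegrableOn F₁ Ω) (h₂ : LocallyIntegrableOn F₂ Ω)
    (h : ∀ ψ, IsTestFunction Ω ψ → ∫ x in Ω, ψ x • F₁ x = ∫ x in Ω, ψ x • F₂ x) :
    ∀ᵐ x, x ∈ Ω → F₁ x = F₂ x := by
  have hint : ∀ {F : EuclideanSpace ℝ (Fin N) → EuclideanSpace ℝ (Fin N)}
      {ψ : EuclideanSpace ℝ (Fin N) → ℝ}, LocallyIntegrableOn F Ω → IsTestFunction Ω ψ →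
      IntegrableOn (fun x => ψ x • F x) (tsupport ψ) := fun hF hψ =>
    (hF.integrableOn_compact_subset hψ.tsupport_subset
      hψ.hasCompactSupport).continuousOn_smul hψ.contDiff.continuous.continuousOn
      hψ.hasCompactSupport
  have := hΩ.ae_eq_zero_of_integral_contDiff_smul_eq_zero (h₁.sub h₂) fun ψ h1 h2 h3 => by
    have hψ : IsTestFunction Ω ψ := ⟨h1, h2, h3⟩
    have h4 := h ψ hψ
    have h0 : ∀ F : EuclideanSpace ℝ (Fin N) → EuclideanSpace ℝ (Fin N), ∀ x, x ∉ tsupport ψ →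
        ψ x • F x = 0 := fun F x hx => by rw [image_eq_zero_of_notMem_tsupport hx, zero_smul]
    rw [setIntegral_eq_setIntegral_of_tsupport_subset h3 (h0 F₁),
      setIntegral_eq_setIntegral_of_tsupport_subset h3 (h0 F₂)] at h4
    rw [← setIntegral_eq_integral_of_forall_compl_eq_zero (h0 (F₁ - F₂))]
    simp only [Pi.sub_apply, smul_sub]
    rw [integral_sub (hint h₁ hψ) (hint h₂ hψ), h4, sub_self]
  filter_upwards [this] with x hx hxΩ
  exact sub_eq_zero.1 (hx hxΩ)

theorem IsWeakGradient.restrict (h : IsWeakGradient Set.univ u Du) :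
    IsWeakGradient Ω u Du := by
  refine ⟨h.1.mono_set (Set.subset_univ _), h.2.mono_set (Set.subset_univ _), fun ψ hψ => ?_⟩
  have h1 := h.integral_eq ψ (hψ.mono (Set.subset_univ _))
  rw [Measure.restrict_univ] at h1
  rw [setIntegral_eq_integral_of_forall_compl_eq_zero,
    setIntegral_eq_integral_of_forall_compl_eq_zero, h1]
  · exact fun x hx => by rw [hψ.eq_zero_of_notMem hx, zero_smul]
  · exact fun x hx => by
      rw [hψ.gradient_eq_zero_of_notMem_tsupport fun h => hx (hψ.tsupport_subset h), smul_zero]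

theorem IsApproxSeq.isH1Loc (h : IsApproxSeq Ω v G φ) (hw : IsWeakGradient Set.univ v G) :
    IsH1Loc Ω v G :=
  ⟨hw.restrict, fun _ hK _ => h.memLp hK, fun _ _ _ => h.memLp_grad.restrict _⟩

/-- Product rule: if `v` is the limit of test functions, then `v u` has the weak gradient
`v ∇u + u ∇v`. -/
theorem IsH1Loc.integral_mul_smul_gradient (hu : IsH1Loc Ω u Du) (h : IsApproxSeq Ω v G φ)
    {ψ : EuclideanSpace ℝ (Fin N) → ℝ} (hψ : IsTestFunction Ω ψ) :
    ∫ x in Ω, (v x * u x) • gradient ψ x = - ∫ x in Ω, ψ x • (v x • Du x + u x • G x) := by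
  set K := tsupport ψ with hK
  have hKc : IsCompact K := hψ.hasCompactSupport
  have hψ0 : ∀ x, x ∉ K → ψ x = 0 := fun x hx => image_eq_zero_of_notMem_tsupport hx
  have hdψ0 : ∀ x, x ∉ K → gradient ψ x = 0 := fun x hx =>
    hψ.gradient_eq_zero_of_notMem_tsupport hx
  have hu2 := hu.memLp K hKc hψ.tsupport_subset
  have hDu2 := hu.memLp_grad K hKc hψ.tsupport_subset
  have hv2 := h.memLp hKc
  have hG2 : MemLp G 2 (volume.restrict K) := h.memLp_grad.restrict K
  have hA : MemLp (fun x => u x • gradient ψ x) 2 (volume.restrict K) :=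
    (hψ.memLp_gradient ⊤ K).smul hu2
  have hB : MemLp (fun x => u x * ψ x) 2 (volume.restrict K) := (hψ.memLp ⊤ K).smul hu2
  have hC : MemLp (fun x => ψ x • Du x) 2 (volume.restrict K) := hDu2.smul (hψ.memLp ⊤ K)
  have hφ2 : ∀ n, MemLp (φ n) 2 (volume.restrict K) := fun n => (h.isTestFunction n).memLp 2 K
  have hdφ2 : ∀ n, MemLp (gradient (φ n)) 2 (volume.restrict K) := fun n =>
    (h.isTestFunction n).memLp_gradient 2 K
  have hconst : ∀ {F : Type} [NormedAddCommGroup F] (f : EuclideanSpace ℝ (Fin N) → F),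
      Tendsto (fun _ : ℕ => eLpNorm (f - f) 2 (volume.restrict K)) atTop (𝓝 0) := fun f => by
    simp
  have hi : ∀ {f : EuclideanSpace ℝ (Fin N) → ℝ}
      {g : EuclideanSpace ℝ (Fin N) → EuclideanSpace ℝ (Fin N)},
      MemLp f 2 (volume.restrict K) → MemLp g 2 (volume.restrict K) →
      IntegrableOn (fun x => f x • g x) K := fun hf hg =>
    memLp_one_iff_integrable.1 (hg.smul hf)
  have l1 := tendsto_integral_smul_of_tendsto_eLpNorm_two hφ2 hv2 (fun _ => hA) hA
    (h.tendsto_loc K hKc) (hconst _)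
  have l2 := tendsto_integral_smul_of_tendsto_eLpNorm_two (fun _ => hB) hB hdφ2 hG2
    (hconst _) (h.tendsto_grad_restrict K)
  have l3 := tendsto_integral_smul_of_tendsto_eLpNorm_two hφ2 hv2 (fun _ => hC) hC
    (h.tendsto_loc K hKc) (hconst _)
  have heq : ∀ n, (∫ x in K, φ n x • u x • gradient ψ x) +
      ∫ x in K, (u x * ψ x) • gradient (φ n) x = - ∫ x in K, φ n x • ψ x • Du x := fun n => by
    have h1 := hu.isWeakGradient.integral_eq _ ((h.isTestFunction n).mul hψ)
    rw [setIntegral_eq_setIntegral_of_tsupport_subset hψ.tsupport_subset,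
      setIntegral_eq_setIntegral_of_tsupport_subset (K := K) hψ.tsupport_subset] at h1
    · rw [← integral_add (hi (hφ2 n) hA) (hi hB (hdφ2 n))]
      simp_rw [(h.isTestFunction n).gradient_mul hψ] at h1
      simp_rw [smul_smul] at h1 ⊢
      rw [← h1]
      refine integral_congr_ae (ae_of_all _ fun x => ?_)
      simp only [smul_add, smul_smul]
      ring_nf
    · exact fun x hx => by rw [hψ0 x hx, mul_zero, zero_smul]
    · exact fun x hx => by
        rw [(h.isTestFunction n).gradient_mul hψ, hψ0 x hx, hdψ0 x hx]
        simp
  have hlim := tendsto_nhds_unique ((l1.add l2).congr heq) l3.neg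
  rw [setIntegral_eq_setIntegral_of_tsupport_subset (K := K) hψ.tsupport_subset,
    setIntegral_eq_setIntegral_of_tsupport_subset (K := K) hψ.tsupport_subset]
  · have e1 : ∫ x in K, (v x * u x) • gradient ψ x = ∫ x in K, v x • u x • gradient ψ x := by
      simp_rw [smul_smul]
    have e2 : ∫ x in K, ψ x • (v x • Du x + u x • G x) =
        (∫ x in K, v x • ψ x • Du x) + ∫ x in K, (u x * ψ x) • G x := by
      rw [← integral_add (hi hv2 hC) (hi hB hG2)]
      refine integral_congr_ae (ae_of_all _ fun x => ?_)
      simp only [smul_add, smul_smul]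
      ring_nf
    rw [e1, e2, eq_sub_of_add_eq hlim]
    abel
  · exact fun x hx => by rw [hψ0 x hx, zero_smul]
  · exact fun x hx => by rw [hdψ0 x hx, smul_zero]

theorem IsH1Loc.locallyIntegrableOn_smul (hΩ : IsOpen Ω) (hu : IsH1Loc Ω u Du)
    (hv : IsH1Loc Ω v G) : LocallyIntegrableOn (fun x => v x • Du x + u x • G x) Ω := by
  rw [locallyIntegrableOn_iff hΩ.isLocallyClosed]
  intro K hKΩ hK
  have h1 : IntegrableOn (fun x => v x • Du x) K := memLp_one_iff_integrable.1
    ((hu.memLp_grad K hK hKΩ).smul (hv.memLp K hK hKΩ))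
  have h2 : IntegrableOn (fun x => u x • G x) K := memLp_one_iff_integrable.1
    ((hv.memLp_grad K hK hKΩ).smul (hu.memLp K hK hKΩ))
  exact h1.add h2

/-- The gradients of `u` and of its positive part agree on `{u > 0}`. Both products `u₊ u` and
`u₊ u₊` are the same function, so their weak gradients `u₊ ∇u + u ∇u₊` and `2 u₊ ∇u₊` agree. -/
theorem IsH1Loc.ae_grad_eq_grad_posPart (hΩ : IsOpen Ω) (hu : IsH1Loc Ω u Du)
    (h : IsApproxSeq Ω v G φ) (hw : IsWeakGradient Set.univ v G)
    (huv : ∀ x ∈ Ω, v x = max (u x) 0) :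
    ∀ᵐ x, x ∈ Ω → 0 < v x → Du x = G x := by
  have hv := h.isH1Loc hw
  have key := ae_eq_of_forall_setIntegral_smul_eq hΩ (hu.locallyIntegrableOn_smul hΩ hv)
    (hv.locallyIntegrableOn_smul hΩ hv) fun ψ hψ => by
      rw [← neg_inj, ← hu.integral_mul_smul_gradient h hψ, ← hv.integral_mul_smul_gradient h hψ]
      refine setIntegral_congr_fun hΩ.measurableSet fun x hx => ?_
      simp only [huv x hx]
      congr 1
      rcases le_total (u x) 0 with h0 | h0
      · simp [h0]
      · simp [h0]
  filter_upwards [key] with x hx hxΩ hpos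
  have h1 := hx hxΩ
  have h2 : u x = v x := by
    have := huv x hxΩ
    rw [this] at hpos ⊢
    rw [max_eq_left (le_of_lt (by simpa using hpos))]
  rw [h2] at h1
  exact smul_right_injective _ hpos.ne' (add_right_cancel h1)

/-- Chain rule for a smooth function with bounded derivative. -/
theorem IsApproxSeq.isWeakGradient_comp (h : IsApproxSeq Ω v G φ) {a : ℝ → ℝ}
    (ha : ContDiff ℝ ∞ a) (ha0 : a 0 = 0) {L : ℝ} (haL : ∀ t, |deriv a t| ≤ L) :
    IsWeakGradient Set.univ (fun x => a (v x)) (fun x => deriv a (v x) • G x) := by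
  have hL : 0 ≤ L := (abs_nonneg _).trans (haL 0)
  have ha' : Continuous (deriv a) := ha.continuous_deriv (by simp)
  have hlip : ∀ s t, |a s - a t| ≤ L * |s - t| := fun s t => by
    have := Convex.norm_image_sub_le_of_norm_deriv_le (𝕜 := ℝ) (f := a) (s := Set.univ)
      (x := t) (y := s) (C := L) (fun x _ => ha.differentiable (by simp) x) (fun x _ => haL x)
      convex_univ trivial trivial
    simpa using this
  have hav : AEStronglyMeasurable (fun x => a (v x)) :=
    ha.continuous.comp_aestronglyMeasurable h.aestronglyMeasurable
  have ha'v : AEStronglyMeasurable (fun x => deriv a (v x)) :=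
    ha'.comp_aestronglyMeasurable h.aestronglyMeasurable
  have hav2 : ∀ {K : Set (EuclideanSpace ℝ (Fin N))}, IsCompact K →
      MemLp (fun x => a (v x)) 2 (volume.restrict K) := fun hK =>
    (h.memLp hK).of_le_mul (c := L) hav.restrict (ae_of_all _ fun x => by
      simpa [ha0] using hlip (v x) 0)
  have hGa : MemLp (fun x => deriv a (v x) • G x) 2 :=
    h.memLp_grad.of_le_mul (c := L) (ha'v.smul h.aestronglyMeasurable_grad) (ae_of_all _ fun x => by
      rw [norm_smul]
      exact mul_le_mul_of_nonneg_right (haL _) (norm_nonneg _))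
  refine ⟨?_, ?_, fun ψ hψ => ?_⟩
  · rw [locallyIntegrableOn_iff isOpen_univ.isLocallyClosed]
    intro K _ hK
    have := isFiniteMeasure_restrict.2 (hK.measure_lt_top (μ := volume)).ne
    exact (hav2 hK).integrable one_le_two
  · rw [locallyIntegrableOn_iff isOpen_univ.isLocallyClosed]
    intro K _ hK
    have := isFiniteMeasure_restrict.2 (hK.measure_lt_top (μ := volume)).ne
    exact (hGa.restrict K).integrable one_le_two
  set K := tsupport ψ with hK
  have hKc : IsCompact K := hψ.hasCompactSupport
  have hψ0 : ∀ x, x ∉ K → ψ x = 0 := fun x hx => image_eq_zero_of_notMem_tsupport hx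
  have hdψ0 : ∀ x, x ∉ K → gradient ψ x = 0 := fun x hx =>
    hψ.gradient_eq_zero_of_notMem_tsupport hx
  have hconst : ∀ {F : Type} [NormedAddCommGroup F] (f : EuclideanSpace ℝ (Fin N) → F),
      Tendsto (fun _ : ℕ => eLpNorm (f - f) 2 (volume.restrict K)) atTop (𝓝 0) := fun f => by
    simp
  have hψa : ∀ {w : EuclideanSpace ℝ (Fin N) → ℝ}, AEStronglyMeasurable w →
      MemLp (fun x => ψ x * deriv a (w x)) 2 (volume.restrict K) := fun hw =>
    (hψ.memLp 2 K).of_le_mul (c := L)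
      ((hψ.contDiff.continuous.aestronglyMeasurable).mul
        (ha'.comp_aestronglyMeasurable hw.restrict)) (ae_of_all _ fun x => by
      rw [norm_mul, mul_comm]
      exact mul_le_mul_of_nonneg_right (haL _) (norm_nonneg _))
  have hφm : ∀ n, AEStronglyMeasurable (φ n) := fun n =>
    (h.isTestFunction n).contDiff.continuous.aestronglyMeasurable
  have l1 := tendsto_integral_smul_of_tendsto_eLpNorm_two
    (fun n => ((h.isTestFunction n).comp ha ha0).memLp 2 K) (hav2 hKc)
    (fun _ => hψ.memLp_gradient 2 K) (hψ.memLp_gradient 2 K) (by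
      have h0 := ENNReal.Tendsto.const_mul (a := ENNReal.ofReal L) (h.tendsto_loc K hKc)
        (Or.inr ENNReal.ofReal_ne_top)
      rw [mul_zero] at h0
      refine tendsto_of_tendsto_of_tendsto_of_le_of_le tendsto_const_nhds h0 (fun _ => zero_le)
        fun n => ?_
      exact eLpNorm_le_mul_eLpNorm_of_ae_le_mul (ae_of_all _ fun x => hlip _ _) _) (hconst _)
  have l2 := tendsto_integral_smul_of_tendsto_eLpNorm_two
    (fun n => hψa (hφm n)) (hψa h.aestronglyMeasurable)
    (fun n => (h.isTestFunction n).memLp_gradient 2 K) (h.memLp_grad.restrict K) (by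
      refine tendsto_eLpNorm_two_of_dominated (B := fun x => |2 * L * ψ x|) (fun n => (hψa (hφm n)).1)
        (hψa h.aestronglyMeasurable).1 (((hψ.memLp 2 K).const_mul (2 * L)).abs) (fun n => ?_) ?_
      · refine ae_of_all _ fun x => ?_
        rw [← mul_sub, norm_mul, abs_mul, abs_of_nonneg (show 0 ≤ 2 * L by positivity), mul_comm]
        refine mul_le_mul_of_nonneg_right ?_ (norm_nonneg _)
        refine (norm_sub_le _ _).trans ?_
        linarith [haL (φ n x), haL (v x), Real.norm_eq_abs (deriv a (φ n x)),
          Real.norm_eq_abs (deriv a (v x))]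
      · filter_upwards [ae_restrict_of_ae h.tendsto_ae] with x hx
        exact ((ha'.tendsto _).comp hx).const_mul _) (h.tendsto_grad_restrict K)
  have heq : ∀ n, ∫ x in K, a (φ n x) • gradient ψ x =
      - ∫ x in K, (ψ x * deriv a (φ n x)) • gradient (φ n) x := fun n => by
    have h1 := ((h.isTestFunction n).comp ha ha0).integral_smul_gradient hψ
    simp_rw [(h.isTestFunction n).gradient_comp ha, smul_smul] at h1
    rw [setIntegral_eq_integral_of_forall_compl_eq_zero,
      setIntegral_eq_integral_of_forall_compl_eq_zero, h1]
    · exact fun x hx => by rw [hψ0 x hx, zero_mul, zero_smul]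
    · exact fun x hx => by rw [hdψ0 x hx, smul_zero]
  have hlim := tendsto_nhds_unique (l1.congr heq) l2.neg
  rw [setIntegral_eq_setIntegral_of_tsupport_subset (K := K) (Set.subset_univ _),
    setIntegral_eq_setIntegral_of_tsupport_subset (K := K) (Set.subset_univ _), hlim]
  · simp_rw [smul_smul]
  · exact fun x hx => by rw [hψ0 x hx, zero_smul]
  · exact fun x hx => by rw [hdψ0 x hx, smul_zero]

end Calculus

/-! ### Bounded truncations and cut-offs -/

/-- The smooth bounded truncation `t ↦ arctan (δ t) / δ` of the identity, which tends to the
identity as `δ → 0` and to `0` as `δ → ∞`. -/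
noncomputable def arctanTrunc (δ t : ℝ) : ℝ := Real.arctan (δ * t) / δ

section ArctanTrunc

variable {δ : ℝ}

theorem contDiff_arctanTrunc : ContDiff ℝ ∞ (arctanTrunc δ) := by
  unfold arctanTrunc
  exact (contDiff_const.mul contDiff_id).arctan.div_const δ

@[simp]
theorem arctanTrunc_zero : arctanTrunc δ 0 = 0 := by simp [arctanTrunc]

theorem deriv_arctanTrunc (hδ : 0 < δ) (t : ℝ) :
    deriv (arctanTrunc δ) t = (1 + (δ * t) ^ 2)⁻¹ := by
  have h := (((hasDerivAt_id t).const_mul δ).arctan.div_const δ).deriv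
  refine (show deriv (arctanTrunc δ) t = _ from h).trans ?_
  simp only [id_eq]
  field_simp

theorem deriv_arctanTrunc_nonneg (hδ : 0 < δ) (t : ℝ) : 0 ≤ deriv (arctanTrunc δ) t := by
  rw [deriv_arctanTrunc hδ]
  positivity

theorem abs_deriv_arctanTrunc_le (hδ : 0 < δ) (t : ℝ) : |deriv (arctanTrunc δ) t| ≤ 1 := by
  rw [abs_of_nonneg (deriv_arctanTrunc_nonneg hδ t), deriv_arctanTrunc hδ]
  exact inv_le_one_of_one_le₀ (by nlinarith [sq_nonneg (δ * t)])

theorem abs_arctanTrunc_le (hδ : 0 < δ) (t : ℝ) : |arctanTrunc δ t| ≤ Real.pi / 2 / δ := by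
  rw [arctanTrunc, abs_div, abs_of_pos hδ]
  exact div_le_div_of_nonneg_right (abs_le.2 ⟨(Real.neg_pi_div_two_lt_arctan _).le,
    (Real.arctan_lt_pi_div_two _).le⟩) hδ.le

theorem arctanTrunc_nonneg (hδ : 0 < δ) {t : ℝ} (ht : 0 ≤ t) : 0 ≤ arctanTrunc δ t :=
  div_nonneg (Real.arctan_nonneg.2 (by positivity)) hδ.le

theorem arctanTrunc_le_self (hδ : 0 < δ) {t : ℝ} (ht : 0 ≤ t) : arctanTrunc δ t ≤ t := by
  have := Convex.norm_image_sub_le_of_norm_deriv_le (𝕜 := ℝ) (f := arctanTrunc δ) (s := Set.univ)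
    (x := 0) (y := t) (C := 1) (fun x _ => contDiff_arctanTrunc.differentiable (by simp) x)
    (fun x _ => abs_deriv_arctanTrunc_le hδ x) convex_univ trivial trivial
  simp only [arctanTrunc_zero, sub_zero, one_mul, Real.norm_eq_abs, abs_of_nonneg ht] at this
  exact (le_abs_self _).trans this

theorem tendsto_arctanTrunc {δ : ℕ → ℝ} (hδ : ∀ n, 0 < δ n) (hlim : Tendsto δ atTop (𝓝 0))
    (t : ℝ) : Tendsto (fun n => arctanTrunc (δ n) t) atTop (𝓝 t) := by
  have h1 : HasDerivAt (fun s => Real.arctan (s * t)) t 0 := by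
    simpa using ((hasDerivAt_id (0 : ℝ)).mul_const t).arctan
  have h2 : Tendsto δ atTop (𝓝[≠] 0) :=
    tendsto_nhdsWithin_iff.2 ⟨hlim, Eventually.of_forall fun n => (hδ n).ne'⟩
  refine (h1.tendsto_slope_zero.comp h2).congr fun n => ?_
  simp [arctanTrunc, div_eq_inv_mul]

end ArctanTrunc

theorem deriv_smoothTransition_nonneg (t : ℝ) : 0 ≤ deriv Real.smoothTransition t :=
  Real.smoothTransition.monotone.deriv_nonneg

theorem exists_deriv_smoothTransition_le : ∃ L, ∀ t, deriv Real.smoothTransition t ≤ L := by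
  have hc : Continuous (deriv Real.smoothTransition) :=
    (Real.smoothTransition.contDiff (n := 1)).continuous_deriv le_rfl
  have hs : HasCompactSupport (deriv Real.smoothTransition) := by
    refine HasCompactSupport.intro (isCompact_Icc (a := (0 : ℝ)) (b := 1)) fun t ht => ?_
    rw [Set.mem_Icc, not_and_or, not_le, not_le] at ht
    have hloc : ∃ c, Real.smoothTransition =ᶠ[𝓝 t] fun _ => c := by
      rcases ht with ht | ht
      · exact ⟨0, (gt_mem_nhds ht).mono fun s hs => Real.smoothTransition.zero_of_nonpos hs.le⟩
      · exact ⟨1, (lt_mem_nhds ht).mono fun s hs => Real.smoothTransition.one_of_one_le hs.le⟩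
    obtain ⟨c, hc⟩ := hloc
    rw [hc.deriv_eq, deriv_const]
  obtain ⟨L, hL⟩ := hc.bounded_above_of_compact_support hs
  exact ⟨L, fun t => (le_abs_self _).trans (hL t)⟩

/-! ### The gradient on the zero set, and products with test functions -/

section

variable {N : ℕ} {Ω : Set (EuclideanSpace ℝ (Fin N))} {z v η : EuclideanSpace ℝ (Fin N) → ℝ}
  {Dz G : EuclideanSpace ℝ (Fin N) → EuclideanSpace ℝ (Fin N)}
  {φ : ℕ → EuclideanSpace ℝ (Fin N) → ℝ}

/-- The weak gradient of `v` vanishes on `{v = 0}`: the truncations `arctan (c v) / c` tend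
uniformly to `0` as `c → ∞`, while their gradients tend to `1_{v = 0} ∇v`. -/
theorem IsApproxSeq.ae_grad_eq_zero (h : IsApproxSeq Ω v G φ)
    (hw : IsWeakGradient Set.univ v G) : ∀ᵐ x, v x = 0 → G x = 0 := by
  have hGl := locallyIntegrableOn_univ.1 hw.2
  have hc : ∀ n : ℕ, (0 : ℝ) < n + 1 := fun n => by positivity
  set χ : EuclideanSpace ℝ (Fin N) → ℝ := fun x => if v x = 0 then 1 else 0 with hχ
  have hlimpt : ∀ x, Tendsto (fun n : ℕ => deriv (arctanTrunc ((n : ℝ) + 1)) (v x)) atTop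
      (𝓝 (χ x)) := fun x => by
    simp_rw [deriv_arctanTrunc (hc _)]
    by_cases hx : v x = 0
    · simp [hχ, hx]
    · simp only [hχ, hx, if_false]
      have h1 : Tendsto (fun n : ℕ => (((n : ℝ) + 1) * v x) ^ 2) atTop atTop := by
        simp_rw [mul_pow]
        exact ((tendsto_pow_atTop two_ne_zero).comp (tendsto_atTop_add_const_right _ _
          tendsto_natCast_atTop_atTop)).atTop_mul_const (by positivity)
      exact (tendsto_atTop_add_const_left _ 1 h1).inv_tendsto_atTop
  have hχG : LocallyIntegrable (fun x => χ x • G x) := by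
    have hm : AEStronglyMeasurable χ :=
      aestronglyMeasurable_of_tendsto_ae atTop (fun n => (contDiff_arctanTrunc.continuous_deriv
        (by simp)).comp_aestronglyMeasurable h.aestronglyMeasurable) (ae_of_all _ hlimpt)
    refine hGl.mono (hm.smul hGl.aestronglyMeasurable) (ae_of_all _ fun x => ?_)
    rw [norm_smul]
    by_cases hx : v x = 0 <;> simp [hχ, hx]
  have key := ae_eq_of_forall_setIntegral_smul_eq (N := N) isOpen_univ
    (locallyIntegrableOn_univ.2 hχG) (F₂ := fun _ => 0)
    (locallyIntegrableOn_univ.2 (locallyIntegrable_const 0)) fun ψ hψ => by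
      simp only [smul_zero, integral_zero]
      have hψG := hGl.integrable_smul_left_of_hasCompactSupport hψ.contDiff.continuous
        hψ.hasCompactSupport
      have l1 : Tendsto (fun n : ℕ => ∫ x in Set.univ,
          ψ x • deriv (arctanTrunc ((n : ℝ) + 1)) (v x) • G x) atTop
          (𝓝 (∫ x in Set.univ, ψ x • χ x • G x)) := by
        refine tendsto_integral_of_dominated_convergence (fun x => ‖ψ x • G x‖) (fun n => ?_)
          hψG.norm.restrict (fun n => ae_of_all _ fun x => ?_) (ae_of_all _ fun x => ?_)
        · exact (hψ.contDiff.continuous.aestronglyMeasurable.smul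
            (((contDiff_arctanTrunc.continuous_deriv (by simp)).comp_aestronglyMeasurable
              h.aestronglyMeasurable).smul h.aestronglyMeasurable_grad)).restrict
        · rw [smul_comm, norm_smul]
          exact mul_le_of_le_one_left (norm_nonneg _) (abs_deriv_arctanTrunc_le (hc n) _)
        · exact ((hlimpt x).smul_const _).const_smul _
      have l2 : Tendsto (fun n : ℕ => ∫ x in Set.univ,
          arctanTrunc ((n : ℝ) + 1) (v x) • gradient ψ x) atTop (𝓝 0) := by
        have hb : Tendsto (fun n : ℕ => Real.pi / 2 / ((n : ℝ) + 1) *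
            ∫ x in Set.univ, ‖gradient ψ x‖) atTop (𝓝 0) := by
          have := (tendsto_const_div_atTop_nhds_zero_nat (Real.pi / 2)).comp (tendsto_add_atTop_nat 1)
          simpa using this.mul_const (∫ x in Set.univ, ‖gradient ψ x‖)
        refine squeeze_zero_norm (fun n => ?_) hb
        rw [← integral_const_mul]
        refine norm_integral_le_of_norm_le ?_ (ae_of_all _ fun x => ?_)
        · exact ((hψ.continuous_gradient.integrable_of_hasCompactSupport
            hψ.hasCompactSupport_gradient).norm.const_mul _).restrict
        · rw [norm_smul]
          exact mul_le_mul_of_nonneg_right (abs_arctanTrunc_le (hc n) _) (norm_nonneg _)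
      have heq : ∀ n : ℕ, ∫ x in Set.univ, arctanTrunc ((n : ℝ) + 1) (v x) • gradient ψ x =
          - ∫ x in Set.univ, ψ x • deriv (arctanTrunc ((n : ℝ) + 1)) (v x) • G x := fun n =>
        (h.isWeakGradient_comp contDiff_arctanTrunc arctanTrunc_zero
          (abs_deriv_arctanTrunc_le (hc n))).integral_eq ψ hψ
      have := tendsto_nhds_unique (l2.congr heq) l1.neg
      exact neg_eq_zero.1 this.symm
  filter_upwards [key] with x hx hx0
  simpa [hχ, hx0] using hx trivial

/-- Product rule for a weakly differentiable function and a test function. -/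
theorem IsWeakGradient.mul_isTestFunction (h : IsWeakGradient Set.univ z Dz)
    (hη : IsTestFunction Ω η) :
    IsWeakGradient Set.univ (fun x => z x * η x) (fun x => η x • Dz x + z x • gradient η x) := by
  have hz := locallyIntegrableOn_univ.1 h.1
  have hDz := locallyIntegrableOn_univ.1 h.2
  have i1 : Integrable fun x => η x • Dz x :=
    hDz.integrable_smul_left_of_hasCompactSupport hη.contDiff.continuous hη.hasCompactSupport
  have i2 : Integrable fun x => z x • gradient η x :=
    hz.integrable_smul_right_of_hasCompactSupport hη.continuous_gradient
      hη.hasCompactSupport_gradient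
  have i3 : Integrable fun x => z x • η x :=
    hz.integrable_smul_right_of_hasCompactSupport hη.contDiff.continuous hη.hasCompactSupport
  refine ⟨locallyIntegrableOn_univ.2 i3.locallyIntegrable,
    locallyIntegrableOn_univ.2 (i1.add i2).locallyIntegrable, fun ψ hψ => ?_⟩
  have h1 := h.integral_eq _ (hη.mul hψ)
  have h2 : ∫ x in Set.univ, (z x * η x) • gradient ψ x =
      (∫ x in Set.univ, z x • gradient (fun x => η x * ψ x) x) -
        ∫ x in Set.univ, ψ x • z x • gradient η x := by
    rw [← integral_sub]
    · refine integral_congr_ae (ae_of_all _ fun x => ?_)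
      simp only [hη.gradient_mul hψ, smul_add, smul_smul]
      rw [mul_comm (ψ x), add_sub_cancel_right]
    · exact (hz.integrable_smul_right_of_hasCompactSupport (hη.mul hψ).continuous_gradient
        (hη.mul hψ).hasCompactSupport_gradient).restrict
    · exact (i2.locallyIntegrable.integrable_smul_left_of_hasCompactSupport
        hψ.contDiff.continuous hψ.hasCompactSupport).restrict
  rw [h2, h1]
  simp only [smul_add]
  rw [integral_add]
  · simp_rw [mul_comm (η _), mul_smul]
    abel
  · exact (i1.locallyIntegrable.integrable_smul_left_of_hasCompactSupport
        hψ.contDiff.continuous hψ.hasCompactSupport).restrict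
  · exact (i2.locallyIntegrable.integrable_smul_left_of_hasCompactSupport
        hψ.contDiff.continuous hψ.hasCompactSupport).restrict

end

/-! ### Testing the inequality -/

/-- No integrability is needed: a Bochner integral that does not exist is `0`. In particular iterated
Bochner integrals are bounded by the iterated lower Lebesgue integrals of any nonnegative majorant. -/
theorem ofReal_integral_le_lintegral_ofReal {X : Type*} [MeasurableSpace X] {μ : Measure X}
    (f : X → ℝ) : ENNReal.ofReal (∫ x, f x ∂μ) ≤ ∫⁻ x, ENNReal.ofReal (f x) ∂μ := by
  by_cases hf : Integrable f μ
  · have h1 : ∫ x, f x ∂μ ≤ ∫ x, max (f x) 0 ∂μ :=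
      integral_mono hf hf.pos_part fun x => le_max_left _ _
    refine (ENNReal.ofReal_le_ofReal h1).trans ?_
    rw [ofReal_integral_eq_lintegral_ofReal hf.pos_part (ae_of_all _ fun x => le_max_right _ _)]
    refine lintegral_mono fun x => ?_
    rcases le_total (f x) 0 with h | h
    · simp [h]
    · simp [h]
  · simp [integral_undef hf]

/-- Fatou's lemma, for an almost everywhere convergent sequence. -/
theorem lintegral_le_of_tendsto_ae {X : Type*} [MeasurableSpace X] {μ : Measure X}
    {f : ℕ → X → ℝ≥0∞} {g : X → ℝ≥0∞} {c : ℕ → ℝ≥0∞} {C : ℝ≥0∞} (hf : ∀ n, AEMeasurable (f n) μ)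
    (hlim : ∀ᵐ x ∂μ, Tendsto (fun n => f n x) atTop (𝓝 (g x)))
    (hle : ∀ n, ∫⁻ x, f n x ∂μ ≤ c n) (hc : Tendsto c atTop (𝓝 C)) : ∫⁻ x, g x ∂μ ≤ C := by
  calc ∫⁻ x, g x ∂μ = ∫⁻ x, liminf (fun n => f n x) atTop ∂μ :=
        lintegral_congr_ae (hlim.mono fun x hx => hx.liminf_eq.symm)
    _ ≤ liminf (fun n => ∫⁻ x, f n x ∂μ) atTop := lintegral_liminf_le' hf
    _ ≤ liminf c atTop := liminf_le_liminf (Eventually.of_forall hle)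
    _ = C := hc.liminf_eq

section Testing

variable {N : ℕ} {α p ε : ℝ} {V H : EuclideanSpace ℝ (Fin N) → ℝ}
  {Ω : Set (EuclideanSpace ℝ (Fin N))} {u v : EuclideanSpace ℝ (Fin N) → ℝ}
  {Du G : EuclideanSpace ℝ (Fin N) → EuclideanSpace ℝ (Fin N)}
  {φ : ℕ → EuclideanSpace ℝ (Fin N) → ℝ}

theorem integrable_inner_of_memLp {X : Type*} [MeasurableSpace X] {μ : Measure X}
    {f g : X → EuclideanSpace ℝ (Fin N)} (hf : MemLp f 2 μ) (hg : MemLp g 2 μ) :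
    Integrable (fun x => inner ℝ (f x) (g x)) μ := by
  have h : Integrable (fun x => ‖f x‖ • ‖g x‖) μ := memLp_one_iff_integrable.1 (hg.norm.smul hf.norm)
  exact h.mono' (hf.1.inner hg.1) (ae_of_all _ fun x => norm_inner_le_norm _ _)

/-- The inequality obtained by testing with `w = a(v) b(φ_m)`, where `a` is a bounded truncation of
the identity and `b` is a nondecreasing cut-off. On `{u > 0}` the gradients of `u` and `v = u₊`
agree, and `w` vanishes elsewhere. In `∇v ⋅ ∇w = a'(v) b(φ_m) |∇v|² + a(v) b'(φ_m) ∇v ⋅ ∇φ_m` the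
second term is nonnegative up to an error that is controlled by `‖∇φ_m - ∇v‖`. -/
theorem IsWeakSubsolution.lintegral_le (hα : 0 < α) (hαN : α < N) (hp : 0 < p) (hε : 0 < ε)
    (hVc : Continuous V) (hV : ∀ x, 0 ≤ V x) (hH : ∀ᵐ x, 0 ≤ H x) (hΩ : IsOpen Ω)
    (hu : IsH1Loc Ω u Du) (hsub : IsWeakSubsolution α p ε V H Ω u Du)
    (hv : v = Ω.indicator fun x => max (u x) 0) (hw : IsWeakGradient Set.univ v G)
    (h : IsApproxSeq Ω v G φ) {δ : ℝ} (hδ : 0 < δ) {b : ℝ → ℝ} (hb : ContDiff ℝ ∞ b)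
    (hb0 : b 0 = 0) (hbnn : ∀ t, 0 ≤ b t) (hb1 : ∀ t, b t ≤ 1) {L : ℝ}
    (hb'nn : ∀ t, 0 ≤ deriv b t) (hb'L : ∀ t, deriv b t ≤ L) (m : ℕ) :
    ∫⁻ x, ENNReal.ofReal (ε ^ 2 * (deriv (arctanTrunc δ) (v x) * b (φ m x) * ‖G x‖ ^ 2) +
        V x * (v x * (arctanTrunc δ (v x) * b (φ m x)))) ≤
      ENNReal.ofReal (p / ε ^ α) *
        (∫⁻ x, ∫⁻ y, ENNReal.ofReal (rieszKernel N α (x - y) * (H y * v y * (H x * v x)))) +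
      ENNReal.ofReal (ε ^ 2 * (Real.pi / 2 / δ * L)) *
        (eLpNorm G 2 * eLpNorm (gradient (φ m) - G) 2) := by
  have hvnn : ∀ x, 0 ≤ v x := fun x => by
    rw [hv]
    exact Set.indicator_nonneg (fun _ _ => le_max_right _ _) x
  have hvΩ : ∀ x ∈ Ω, v x = max (u x) 0 := fun x hx => by rw [hv, Set.indicator_of_mem hx]
  have hL : 0 ≤ L := (hb'nn 0).trans (hb'L 0)
  set a := arctanTrunc δ with ha
  set M := Real.pi / 2 / δ with hM
  have hM0 : 0 ≤ M := (abs_nonneg _).trans (abs_arctanTrunc_le hδ 0)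
  have hann : ∀ x, 0 ≤ a (v x) := fun x => arctanTrunc_nonneg hδ (hvnn x)
  have haM : ∀ x, a (v x) ≤ M := fun x => (le_abs_self _).trans (abs_arctanTrunc_le hδ _)
  have hac : Continuous a := contDiff_arctanTrunc.continuous
  have ham : AEStronglyMeasurable (fun x => a (v x)) :=
    hac.comp_aestronglyMeasurable h.aestronglyMeasurable
  have ha'nn : ∀ x, 0 ≤ deriv a (v x) := fun x => deriv_arctanTrunc_nonneg hδ _
  have ha'1 : ∀ x, |deriv a (v x)| ≤ 1 := fun x => abs_deriv_arctanTrunc_le hδ _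
  have hφ := h.isTestFunction m
  have hη : IsTestFunction Ω (fun x => b (φ m x)) := hφ.comp hb hb0
  have hdη : ∀ x, gradient (fun x => b (φ m x)) x = deriv b (φ m x) • gradient (φ m) x :=
    hφ.gradient_comp hb
  set w : EuclideanSpace ℝ (Fin N) → ℝ := fun x => a (v x) * b (φ m x) with hwdef
  set Dw : EuclideanSpace ℝ (Fin N) → EuclideanSpace ℝ (Fin N) := fun x =>
    b (φ m x) • deriv a (v x) • G x + a (v x) • gradient (fun x => b (φ m x)) x with hDw
  have hwnn : ∀ x, 0 ≤ w x := fun x => mul_nonneg (hann x) (hbnn _)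
  have hwv : ∀ x, w x ≤ v x := fun x =>
    (mul_le_of_le_one_right (hann x) (hb1 _)).trans (arctanTrunc_le_self hδ (hvnn x))
  have hG := h.memLp_grad
  have hη2 : MemLp (fun x => b (φ m x)) 2 := by simpa using hη.memLp 2 Set.univ
  have hdη2 : MemLp (gradient fun x => b (φ m x)) 2 := by
    simpa using hη.memLp_gradient 2 Set.univ
  have hw2 : MemLp w 2 :=
    hη2.of_le_mul (c := M) (ham.mul hη.contDiff.continuous.aestronglyMeasurable)
      (ae_of_all _ fun x => by
        rw [norm_mul]
        exact mul_le_mul_of_nonneg_right (abs_arctanTrunc_le hδ _) (norm_nonneg _))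
  have hDw2 : MemLp Dw 2 := by
    have m1 : MemLp (fun x => deriv a (v x) • G x) 2 :=
      hG.of_le ((contDiff_arctanTrunc.continuous_deriv (by simp)).comp_aestronglyMeasurable
        h.aestronglyMeasurable |>.smul hG.1) (ae_of_all _ fun x => by
          rw [norm_smul]
          exact mul_le_of_le_one_left (norm_nonneg _) (ha'1 x))
    have m2 : MemLp (fun x => b (φ m x) • deriv a (v x) • G x) 2 :=
      m1.of_le (hη.contDiff.continuous.aestronglyMeasurable.smul m1.1) (ae_of_all _ fun x => by
          rw [norm_smul, Real.norm_of_nonneg (hbnn _)]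
          exact mul_le_of_le_one_left (norm_nonneg _) (hb1 _))
    have m3 : MemLp (fun x => a (v x) • gradient (fun x => b (φ m x)) x) 2 :=
      hdη2.of_le_mul (c := M) (ham.smul hdη2.1) (ae_of_all _ fun x => by
        rw [norm_smul]
        exact mul_le_mul_of_nonneg_right (abs_arctanTrunc_le hδ _) (norm_nonneg _))
    exact m2.add m3
  have hwgrad : IsWeakGradient Set.univ w Dw :=
    (h.isWeakGradient_comp contDiff_arctanTrunc arctanTrunc_zero
      (abs_deriv_arctanTrunc_le hδ)).mul_isTestFunction hη
  have hwsupp : tsupport w ⊆ tsupport fun x => b (φ m x) := tsupport_mul_subset_right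
  have htest := hsub w Dw ⟨hwgrad.restrict, hw2.restrict _, hDw2.restrict _⟩
    hη.hasCompactSupport.mul_left (hwsupp.trans hη.tsupport_subset) hwnn
  -- rewrite the left-hand side in terms of `v` and `G`
  set J : EuclideanSpace ℝ (Fin N) → ℝ := fun x =>
    ε ^ 2 * inner ℝ (G x) (Dw x) + V x * (v x * w x) with hJ
  have hLHS : ∫ x in Ω, (ε ^ 2 * inner ℝ (Du x) (Dw x) + V x * u x * w x) = ∫ x in Ω, J x := by
    refine setIntegral_congr_ae hΩ.measurableSet ?_
    filter_upwards [hu.ae_grad_eq_grad_posPart hΩ h hw hvΩ, h.ae_grad_eq_zero hw]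
      with x hx1 hx2 hxΩ
    rcases (hvnn x).eq_or_lt with hv0 | hv0
    · have e1 : a (v x) = 0 := by rw [← hv0, ha, arctanTrunc_zero]
      have e2 : G x = 0 := hx2 hv0.symm
      simp [hJ, hwdef, hDw, e1, e2]
    · have e1 : u x = v x := by
        have h1 := hvΩ x hxΩ
        rw [h1] at hv0 ⊢
        rw [max_eq_left (le_of_lt (by simpa using hv0))]
      simp only [hJ]
      rw [hx1 hxΩ hv0, e1]
      ring
  rw [hLHS] at htest
  have hJint : Integrable J := by
    have i1 : Integrable fun x => inner ℝ (G x) (Dw x) := integrable_inner_of_memLp hG hDw2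
    have i2 : Integrable fun x => V x * (v x * w x) := by
      have hc : Continuous fun x => V x * b (φ m x) := hVc.mul hη.contDiff.continuous
      have hs : HasCompactSupport fun x => V x * b (φ m x) := hη.hasCompactSupport.mul_left
      have i3 := (locallyIntegrableOn_univ.1 hw.1).integrable_smul_left_of_hasCompactSupport hc hs
      refine (i3.bdd_mul (c := M) ham (ae_of_all _ fun x => abs_arctanTrunc_le hδ _)).congr
        (ae_of_all _ fun x => ?_)
      simp only [hwdef, smul_eq_mul]
      ring
    exact (i1.const_mul _).add i2
  set err : EuclideanSpace ℝ (Fin N) → ℝ := fun x =>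
    ε ^ 2 * (M * L) * (‖G x‖ * ‖gradient (φ m) x - G x‖) with herr
  have hdiff : MemLp (gradient (φ m) - G) 2 :=
    (show MemLp (gradient (φ m)) 2 by simpa using hφ.memLp_gradient 2 Set.univ).sub hG
  have herrint : Integrable err := by
    have : Integrable fun x => ‖G x‖ • ‖(gradient (φ m) - G) x‖ :=
      memLp_one_iff_integrable.1 (hdiff.norm.smul hG.norm)
    exact this.const_mul _
  have herrle : ENNReal.ofReal (∫ x in Ω, err x) ≤ ENNReal.ofReal (ε ^ 2 * (M * L)) *
        (eLpNorm G 2 * eLpNorm (gradient (φ m) - G) 2) := by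
    refine (ofReal_integral_le_lintegral_ofReal _).trans ?_
    refine (setLIntegral_le_lintegral _ _).trans ?_
    simp only [herr]
    simp_rw [ENNReal.ofReal_mul (show 0 ≤ ε ^ 2 * (M * L) by positivity)]
    rw [lintegral_const_mul' _ _ ENNReal.ofReal_ne_top]
    refine mul_le_mul_right ?_ _
    have h1 := eLpNorm_smul_le_mul_eLpNorm (μ := volume) (p := 2) (q := 2) (r := 1)
      hdiff.norm.1 hG.norm.1
    rw [eLpNorm_norm, eLpNorm_norm, eLpNorm_one_eq_lintegral_enorm] at h1
    refine le_trans (lintegral_mono fun x => ?_) h1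
    rw [← ofReal_norm]
    simp [ENNReal.ofReal_mul]
  set A : EuclideanSpace ℝ (Fin N) → ℝ := fun x =>
    ε ^ 2 * (deriv a (v x) * b (φ m x) * ‖G x‖ ^ 2) + V x * (v x * (a (v x) * b (φ m x))) with hA
  have hAJ : ∀ x, A x ≤ J x + err x := fun x => by
    have e1 : inner ℝ (G x) (Dw x) = deriv a (v x) * b (φ m x) * ‖G x‖ ^ 2 +
        a (v x) * deriv b (φ m x) * (‖G x‖ ^ 2 + inner ℝ (G x) (gradient (φ m) x - G x)) := by
      simp only [hDw, hdη, inner_add_right, inner_smul_right, inner_sub_right,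
        real_inner_self_eq_norm_sq]
      ring
    -- `∇v ⋅ ∇φ_m = |∇v|² + ∇v ⋅ (∇φ_m - ∇v)`, and `a(v) b'(φ_m) ≥ 0`
    have e2 : -(‖G x‖ * ‖gradient (φ m) x - G x‖) ≤
        ‖G x‖ ^ 2 + inner ℝ (G x) (gradient (φ m) x - G x) := by
      have := abs_le.1 (abs_real_inner_le_norm (G x) (gradient (φ m) x - G x))
      nlinarith [sq_nonneg ‖G x‖, this.1]
    have e3 : 0 ≤ a (v x) * deriv b (φ m x) := mul_nonneg (hann x) (hb'nn _)
    have e4 : a (v x) * deriv b (φ m x) ≤ M * L :=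
      mul_le_mul (haM x) (hb'L _) (hb'nn _) hM0
    have e5 := mul_le_mul_of_nonneg_left e2 e3
    have e6 := mul_le_mul_of_nonneg_right e4
      (show 0 ≤ ‖G x‖ * ‖gradient (φ m) x - G x‖ by positivity)
    simp only [hA, hJ, herr, hwdef, e1]
    nlinarith [mul_le_mul_of_nonneg_left
      (show -(M * L * (‖G x‖ * ‖gradient (φ m) x - G x‖)) ≤ a (v x) * deriv b (φ m x) *
        (‖G x‖ ^ 2 + inner ℝ (G x) (gradient (φ m) x - G x)) by linarith) (sq_nonneg ε)]
  have hAnn : ∀ x, 0 ≤ A x := fun x => by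
    have h1 := ha'nn x
    have h2 := hbnn (φ m x)
    have h3 := hV x
    have h4 := hvnn x
    have h5 := hann x
    simp only [hA]
    positivity
  have hAΩ : ∫⁻ x, ENNReal.ofReal (A x) = ∫⁻ x in Ω, ENNReal.ofReal (A x) := by
    rw [← lintegral_indicator hΩ.measurableSet]
    refine lintegral_congr fun x => ?_
    by_cases hx : x ∈ Ω
    · rw [Set.indicator_of_mem hx]
    · rw [Set.indicator_of_notMem hx]
      simp [hA, hφ.eq_zero_of_notMem hx, hb0]
  have hRHS : ENNReal.ofReal (∫ x in Ω, J x) ≤ ENNReal.ofReal (p / ε ^ α) *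
        (∫⁻ x, ∫⁻ y, ENNReal.ofReal (rieszKernel N α (x - y) * (H y * v y * (H x * v x)))) := by
    have hpε : 0 ≤ p / ε ^ α := by positivity
    refine (ENNReal.ofReal_le_ofReal htest).trans ?_
    rw [ENNReal.ofReal_mul hpε]
    refine mul_le_mul_right ?_ _
    refine (ofReal_integral_le_lintegral_ofReal _).trans ?_
    refine le_trans ?_ (setLIntegral_le_lintegral Ω _)
    refine lintegral_mono_ae ?_
    filter_upwards [ae_restrict_of_ae hH] with x hx
    refine (ofReal_integral_le_lintegral_ofReal _).trans ?_
    refine le_trans ?_ (setLIntegral_le_lintegral Ω _)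
    refine lintegral_mono_ae ?_
    filter_upwards [ae_restrict_of_ae hH, ae_restrict_mem hΩ.measurableSet] with y hy hyΩ
    refine ENNReal.ofReal_le_ofReal ?_
    rw [mul_assoc]
    refine mul_le_mul_of_nonneg_left ?_ (rieszKernel_nonneg hα hαN _)
    have huv : u y ≤ v y := by
      rw [hvΩ y hyΩ]
      exact le_max_left _ _
    exact mul_le_mul (mul_le_mul_of_nonneg_left huv hy) (mul_le_mul_of_nonneg_left (hwv x) hx)
      (mul_nonneg hx (hwnn x)) (mul_nonneg hy (hvnn y))
  rw [hAΩ]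
  calc ∫⁻ x in Ω, ENNReal.ofReal (A x) ≤ ∫⁻ x in Ω, ENNReal.ofReal (J x + err x) :=
        lintegral_mono fun x => ENNReal.ofReal_le_ofReal (hAJ x)
    _ = ENNReal.ofReal (∫ x in Ω, (J x + err x)) := by
        exact (ofReal_integral_eq_lintegral_ofReal (hJint.add herrint).restrict
          (ae_of_all _ fun x => (hAnn x).trans (hAJ x))).symm
    _ ≤ ENNReal.ofReal (∫ x in Ω, J x) + ENNReal.ofReal (∫ x in Ω, err x) := by
        rw [integral_add hJint.restrict herrint.restrict]
        exact ENNReal.ofReal_add_le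
    _ ≤ _ := add_le_add hRHS herrle

/-- The energy of `u₊` is bounded by the nonlocal term; formally, this is the inequality tested
with `u₊` itself. -/
theorem IsWeakSubsolution.energy_le (hα : 0 < α) (hαN : α < N) (hp : 0 < p) (hε : 0 < ε)
    (hVc : Continuous V) (hV : ∀ x, 0 ≤ V x) (hH : ∀ᵐ x, 0 ≤ H x) (hΩ : IsOpen Ω)
    (hu : IsH1Loc Ω u Du) (hsub : IsWeakSubsolution α p ε V H Ω u Du)
    (hv : v = Ω.indicator fun x => max (u x) 0) (hw : IsWeakGradient Set.univ v G)
    (h : IsApproxSeq Ω v G φ) :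
    energy ε V v G ≤ ENNReal.ofReal (p / ε ^ α) *
      ∫⁻ x, ∫⁻ y, ENNReal.ofReal (rieszKernel N α (x - y) * (H y * v y * (H x * v x))) := by
  obtain ⟨L, hL⟩ := exists_deriv_smoothTransition_le
  set R := ENNReal.ofReal (p / ε ^ α) *
      ∫⁻ x, ∫⁻ y, ENNReal.ofReal (rieszKernel N α (x - y) * (H y * v y * (H x * v x))) with hR
  have hvnn : ∀ x, 0 ≤ v x := fun x => by
    rw [hv]
    exact Set.indicator_nonneg (fun _ _ => le_max_right _ _) x
  have hvm : AEMeasurable v := h.aestronglyMeasurable.aemeasurable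
  have hGm : AEMeasurable G := h.aestronglyMeasurable_grad.aemeasurable
  set c : ℕ → ℝ := fun k => (k : ℝ) + 1 with hc
  have hc0 : ∀ k, 0 < c k := fun k => by positivity
  set δ : ℕ → ℝ := fun k => 1 / ((k : ℝ) + 1) with hδ
  have hδ0 : ∀ k, 0 < δ k := fun k => by positivity
  set b : ℕ → ℝ → ℝ := fun k t => Real.smoothTransition (c k * t) with hb
  have hbc : ∀ k, ContDiff ℝ ∞ (b k) := fun k =>
    Real.smoothTransition.contDiff.comp (contDiff_const.mul contDiff_id)
  have hb' : ∀ k t, deriv (b k) t = c k * deriv Real.smoothTransition (c k * t) := fun k t => by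
    simp only [hb]
    rw [deriv_comp_mul_left, smul_eq_mul]
  have ha' : ∀ k, Continuous (deriv (arctanTrunc (δ k))) := fun k =>
    contDiff_arctanTrunc.continuous_deriv (by simp)
  have ha : ∀ k, Continuous (arctanTrunc (δ k)) := fun k => contDiff_arctanTrunc.continuous
  have hmeas : ∀ k (w : EuclideanSpace ℝ (Fin N) → ℝ), AEMeasurable w →
      AEMeasurable fun x => ENNReal.ofReal
        (ε ^ 2 * (deriv (arctanTrunc (δ k)) (v x) * b k (w x) * ‖G x‖ ^ 2) +
          V x * (v x * (arctanTrunc (δ k) (v x) * b k (w x)))) := fun k w hwm => by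
    have m1 := (ha' k).measurable.comp_aemeasurable hvm
    have m2 := (ha k).measurable.comp_aemeasurable hvm
    have m3 := (hbc k).continuous.measurable.comp_aemeasurable hwm
    have m4 := hVc.aemeasurable (μ := volume)
    exact ((((m1.mul m3).mul (hGm.norm.pow_const 2)).const_mul _).add
      (m4.mul (hvm.mul (m2.mul m3)))).ennreal_ofReal
  -- first pass to the limit along the approximating sequence, with fixed truncation and cut-off
  have step1 : ∀ k, ∫⁻ x, ENNReal.ofReal
      (ε ^ 2 * (deriv (arctanTrunc (δ k)) (v x) * b k (v x) * ‖G x‖ ^ 2) +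
        V x * (v x * (arctanTrunc (δ k) (v x) * b k (v x)))) ≤ R := fun k => by
    have herr : Tendsto (fun m => R + ENNReal.ofReal (ε ^ 2 * (Real.pi / 2 / δ k * (c k * L))) *
        (eLpNorm G 2 * eLpNorm (gradient (φ m) - G) 2)) atTop (𝓝 R) := by
      have h1 := ENNReal.Tendsto.const_mul h.tendsto_grad (Or.inr h.memLp_grad.eLpNorm_ne_top)
      have h2 := ENNReal.Tendsto.const_mul
        (a := ENNReal.ofReal (ε ^ 2 * (Real.pi / 2 / δ k * (c k * L)))) h1
        (Or.inr ENNReal.ofReal_ne_top)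
      simpa using h2.const_add R
    refine lintegral_le_of_tendsto_ae
      (fun m => hmeas k (φ m) (h.isTestFunction m).contDiff.continuous.aemeasurable) ?_
      (fun m => hsub.lintegral_le hα hαN hp hε hVc hV hH hΩ hu hv hw h (hδ0 k) (hbc k)
        (by simp [hb]) (fun t => Real.smoothTransition.nonneg _)
        (fun t => Real.smoothTransition.le_one _) (fun t => ?_) (fun t => ?_) m) herr
    · filter_upwards [h.tendsto_ae] with x hx
      have h1 := ((hbc k).continuous.tendsto (v x)).comp hx
      exact (ENNReal.continuous_ofReal.tendsto _).comp
        ((((h1.const_mul _).mul_const _).const_mul _).add (((h1.const_mul _).const_mul _).const_mul _))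
    · rw [hb']
      exact mul_nonneg (hc0 k).le (deriv_smoothTransition_nonneg _)
    · rw [hb']
      exact mul_le_mul_of_nonneg_left (hL _) (hc0 k).le
  refine lintegral_le_of_tendsto_ae (fun k => hmeas k v hvm) ?_ step1 tendsto_const_nhds
  filter_upwards [h.ae_grad_eq_zero hw] with x hx
  refine (ENNReal.continuous_ofReal.tendsto _).comp ?_
  rcases (hvnn x).eq_or_lt with h0 | h0
  · simp [hx h0.symm, ← h0]
  · have hδlim : Tendsto δ atTop (𝓝 0) := tendsto_one_div_add_atTop_nhds_zero_nat
    have l1 : Tendsto (fun k => deriv (arctanTrunc (δ k)) (v x)) atTop (𝓝 1) := by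
      simp_rw [deriv_arctanTrunc (hδ0 _)]
      have : Tendsto (fun k => (1 + (δ k * v x) ^ 2)⁻¹) atTop (𝓝 (1 + (0 * v x) ^ 2)⁻¹) :=
        (((hδlim.mul_const _).pow 2).const_add 1).inv₀ (by norm_num)
      simpa using this
    have l2 := tendsto_arctanTrunc hδ0 hδlim (v x)
    have l3 : Tendsto (fun k => b k (v x)) atTop (𝓝 1) := by
      have h1 : Tendsto (fun k => c k * v x) atTop atTop :=
        (tendsto_atTop_add_const_right _ _ tendsto_natCast_atTop_atTop).atTop_mul_const h0
      refine tendsto_const_nhds.congr' ?_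
      filter_upwards [h1.eventually_ge_atTop 1] with k hk
      exact (Real.smoothTransition.one_of_one_le hk).symm
    have := (((l1.mul l3).mul_const (‖G x‖ ^ 2)).const_mul (ε ^ 2)).add
      (((l2.mul l3).const_mul (v x)).const_mul (V x))
    simpa [sq] using this

end Testing

/-! ### Functions of zero energy -/

section ZeroEnergy

variable {N : ℕ} {ε : ℝ} {V v : EuclideanSpace ℝ (Fin N) → ℝ}
  {G : EuclideanSpace ℝ (Fin N) → EuclideanSpace ℝ (Fin N)}

/-- A function on `ℝ^N` with zero weak gradient is constant, because its mollifications are. -/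
theorem IsWeakGradient.exists_ae_eq_const (h : IsWeakGradient Set.univ v G)
    (hG : ∀ᵐ x, G x = 0) : ∃ c, ∀ᵐ x, v x = c := by
  have hv := locallyIntegrableOn_univ.1 h.1
  set ρ : ℕ → ContDiffBump (0 : EuclideanSpace ℝ (Fin N)) := fun n =>
    ⟨1 / ((n : ℝ) + 1), 2 * (1 / ((n : ℝ) + 1)), by positivity, by
      have : (0 : ℝ) < 1 / ((n : ℝ) + 1) := by positivity
      linarith⟩ with hρ
  have hρlim : Tendsto (fun n => (ρ n).rOut) atTop (𝓝 0) := by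
    have := (tendsto_one_div_add_atTop_nhds_zero_nat (𝕜 := ℝ)).const_mul 2
    rwa [mul_zero] at this
  have hae := ContDiffBump.ae_convolution_tendsto_right_of_locallyIntegrable (μ := volume)
    (φ := ρ) (K := 2) hρlim (Eventually.of_forall fun n => le_rfl) hv
  have hconst : ∀ n x, convolution ((ρ n).normed volume) v (ContinuousLinearMap.lsmul ℝ ℝ) volume x
      = convolution ((ρ n).normed volume) v (ContinuousLinearMap.lsmul ℝ ℝ) volume 0 := by
    intro n x
    set f := (ρ n).normed volume with hf
    have hfc : ContDiff ℝ ∞ f := (ρ n).contDiff_normed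
    have hfs : HasCompactSupport f := (ρ n).hasCompactSupport_normed
    have hder := fun x => hfs.hasFDerivAt_convolution_left (ContinuousLinearMap.lsmul ℝ ℝ)
      (hfc.of_le (by simp)) hv x
    refine is_const_of_fderiv_eq_zero (𝕜 := ℝ) (fun x => (hder x).differentiableAt)
      (fun x => ?_) x 0
    rw [(hder x).fderiv, convolution_eq_swap]
    have hfx : IsTestFunction Set.univ fun t => f (x - t) := by
      refine ⟨hfc.comp (contDiff_const.sub contDiff_id), ?_, Set.subset_univ _⟩
      exact hfs.comp_homeomorph (Homeomorph.subLeft x)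
    have hfd : ∀ t, fderiv ℝ f (x - t) =
        - InnerProductSpace.toDual ℝ _ (gradient (fun t => f (x - t)) t) := fun t => by
      have h1 := ((hfc.differentiable (by simp) (x - t)).hasFDerivAt.comp t
        ((hasFDerivAt_id t).const_sub x)).fderiv
      rw [toDual_gradient]
      refine Eq.trans ?_ (congrArg Neg.neg h1.symm)
      ext y
      simp
    have h1 := h.integral_eq _ hfx
    have h2 : ∫ t in Set.univ, f (x - t) • G t = 0 := by
      refine integral_eq_zero_of_ae ?_
      filter_upwards [ae_restrict_of_ae hG] with t ht
      simp [ht]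
    rw [h2, neg_zero, Measure.restrict_univ] at h1
    have hint : Integrable fun t => v t • gradient (fun t => f (x - t)) t :=
      hv.integrable_smul_right_of_hasCompactSupport hfx.continuous_gradient
        hfx.hasCompactSupport_gradient
    have h3 := (InnerProductSpace.toDual ℝ (EuclideanSpace ℝ (Fin N))).toContinuousLinearEquiv.integral_comp_comm
      (fun t => v t • gradient (fun t => f (x - t)) t) (μ := volume)
    rw [h1] at h3
    rw [← neg_eq_zero, ← integral_neg]
    refine Eq.trans (integral_congr_ae (ae_of_all _ fun t => ?_)) (h3.trans (map_zero _))
    ext y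
    simp [hfd, mul_comm]
  obtain ⟨x₀, hx₀⟩ := hae.exists
  refine ⟨v x₀, ?_⟩
  filter_upwards [hae] with x hx
  refine tendsto_nhds_unique hx (hx₀.congr fun n => ?_)
  rw [hconst n x₀, ← hconst n x]

theorem ae_eq_zero_of_energy_eq_zero (hε : 0 < ε) (hVc : Continuous V) (hV : ∀ x, 0 ≤ V x)
    (hVne : V ≠ 0) (h : IsWeakGradient Set.univ v G) (hE : energy ε V v G = 0) :
    ∀ᵐ x, v x = 0 := by
  have hvm : AEMeasurable v := (locallyIntegrableOn_univ.1 h.1).aestronglyMeasurable.aemeasurable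
  have hGm : AEMeasurable G := (locallyIntegrableOn_univ.1 h.2).aestronglyMeasurable.aemeasurable
  have hm : AEMeasurable fun x => ENNReal.ofReal (ε ^ 2 * ‖G x‖ ^ 2 + V x * v x ^ 2) :=
    (((hGm.norm.pow_const 2).const_mul _).add
      (hVc.aemeasurable.mul (hvm.pow_const 2))).ennreal_ofReal
  have h0 := (lintegral_eq_zero_iff' hm).1 hE
  have hboth : ∀ᵐ x, G x = 0 ∧ V x * v x ^ 2 = 0 := by
    filter_upwards [h0] with x hx
    have hle := ENNReal.ofReal_eq_zero.1 hx
    have h1 : 0 ≤ ε ^ 2 * ‖G x‖ ^ 2 := by positivity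
    have h2 : 0 ≤ V x * v x ^ 2 := mul_nonneg (hV x) (sq_nonneg _)
    have h3 : ε ^ 2 * ‖G x‖ ^ 2 = 0 := by linarith
    refine ⟨?_, by linarith⟩
    simpa [hε.ne'] using h3
  obtain ⟨c, hc⟩ := h.exists_ae_eq_const (hboth.mono fun x hx => hx.1)
  -- the constant vanishes because `V` is positive on a nonempty open set
  obtain ⟨x₀, hx₀⟩ : ∃ x, V x ≠ 0 := by
    by_contra! hn
    exact hVne (funext hn)
  have hopen : IsOpen {x | V x ≠ 0} := isOpen_ne_fun hVc continuous_const
  have hne : volume {x | V x ≠ 0} ≠ 0 := (hopen.measure_pos volume ⟨x₀, hx₀⟩).ne'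
  obtain ⟨x, hxV, hx⟩ : ∃ x, V x ≠ 0 ∧ (v x = c ∧ V x * v x ^ 2 = 0) := by
    have hf : ∃ᵐ x, V x ≠ 0 := frequently_ae_iff.2 hne
    exact (hf.and_eventually (hc.and (hboth.mono fun x hx => hx.2))).exists
  have hc0 : c = 0 := by
    rw [← hx.1]
    simpa [hxV] using hx.2
  filter_upwards [hc] with y hy
  rw [hy, hc0]

end ZeroEnergy

end Choquard

theorem mainTheorem8 (N : ℕ) (α p ε : ℝ) (hα : 0 < α) (hαN : α < N) (hp : 0 < p) (hε : 0 < ε)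
    (V H : EuclideanSpace ℝ (Fin N) → ℝ)
    (hVcont : Continuous V) (hVnonneg : ∀ x, 0 ≤ V x) (hVne : V ≠ 0)
    (hHmeas : AEMeasurable H volume) (hHnonneg : ∀ᵐ x, 0 ≤ H x)
    (hH2 : Choquard.HypH2 α p ε V H)
    (Ω : Set (EuclideanSpace ℝ (Fin N))) (hΩ : IsOpen Ω)
    (u : EuclideanSpace ℝ (Fin N) → ℝ)
    (Du : EuclideanSpace ℝ (Fin N) → EuclideanSpace ℝ (Fin N))
    (hu : Choquard.IsH1Loc Ω u Du)
    (huH : ∫⁻ x in Ω, ENNReal.ofReal (H x ^ 2 * ‖x‖ ^ α * u x ^ 2) < ⊤)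
    (hsub : Choquard.IsWeakSubsolution α p ε V H Ω u Du)
    (hupos : ∃ G : EuclideanSpace ℝ (Fin N) → EuclideanSpace ℝ (Fin N),
      Choquard.IsH1V0 ε V Ω (Ω.indicator fun x => max (u x) 0) G) :
    ∀ᵐ x ∂(volume.restrict Ω), u x ≤ 0 := by
  obtain ⟨G, hG⟩ := hupos
  obtain ⟨κ, hκ, hκ1, hκH⟩ := hH2
  set v := Ω.indicator fun x => max (u x) 0 with hv
  have hw := hG.isWeakGradient
  obtain ⟨φ, hφ, -⟩ := hG.exists_isApproxSeq hε hVnonneg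
  have hfin := hG.energy_lt_top hVcont hVnonneg
  have hbound := hsub.energy_le hα hαN hp hε hVcont hVnonneg hHnonneg hΩ hu hv hw hφ
  have hHLS := Choquard.lintegral_lintegral_rieszKernel_le hα hαN
    (f := fun x => H x * v x) (hHmeas.mul hφ.aestronglyMeasurable.aemeasurable)
  have hHv := hκH v G ⟨hw, by
    obtain ⟨ψ, h1, h2⟩ := hG.exists_approx
    exact ⟨ψ, fun n => (h1 n).mono (Set.subset_univ _), h2⟩⟩
  have hC := Choquard.hlsConst_nonneg N α
  have hcontr : Choquard.energy ε V v G ≤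
      ENNReal.ofReal (Choquard.hlsConst N α * p * κ) * Choquard.energy ε V v G := by
    calc Choquard.energy ε V v G
        ≤ ENNReal.ofReal (p / ε ^ α) * (ENNReal.ofReal (Choquard.hlsConst N α) *
            ∫⁻ x, ENNReal.ofReal ((H x * v x) ^ 2 * ‖x‖ ^ α)) :=
          hbound.trans (mul_le_mul_right hHLS _)
      _ = ENNReal.ofReal (Choquard.hlsConst N α * p) * (ENNReal.ofReal (1 / ε ^ α) *
            ∫⁻ x, ENNReal.ofReal ((H x * v x) ^ 2 * ‖x‖ ^ α)) := by
          rw [← mul_assoc, ← mul_assoc, ← ENNReal.ofReal_mul (by positivity),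
            ← ENNReal.ofReal_mul (by positivity)]
          congr 2
          ring
      _ ≤ ENNReal.ofReal (Choquard.hlsConst N α * p) *
            (ENNReal.ofReal κ * Choquard.energy ε V v G) := mul_le_mul_right hHv _
      _ = _ := by rw [← mul_assoc, ← ENNReal.ofReal_mul (by positivity)]
  have hE : Choquard.energy ε V v G = 0 := by
    by_contra hne
    have h1 : ENNReal.ofReal (Choquard.hlsConst N α * p * κ) * Choquard.energy ε V v G <
        1 * Choquard.energy ε V v G :=
      (ENNReal.mul_lt_mul_iff_left hne hfin.ne).2 (by simpa using hκ1)
    rw [one_mul] at h1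
    exact absurd hcontr (not_le.2 h1)
  have hv0 := Choquard.ae_eq_zero_of_energy_eq_zero hε hVcont hVnonneg hVne hw hE
  filter_upwards [ae_restrict_of_ae hv0, ae_restrict_mem hΩ.measurableSet] with x hx hxΩ
  rw [hv, Set.indicator_of_mem hxΩ] at hx
  exact (le_max_left _ _).trans hx.le
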